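/- Let $l\ge 3$ be an integer, let $q\in\mathbb C$ be a primitive $l$-th root of unity and fix a square root $q^{1/2}$ of $q$. Let $U=\mathcal U_q(osp(1|2))$ be the unital associative $\mathbb C$-algebra with generators $e,f,k,k^{-1}$ and relations $$kk^{-1}=k^{-1}k=1,\quad kek^{-1}=qe,\quad kfk^{-1}=q^{-1}f,\quad ef+fe=\frac{k-k^{-1}}{q-q^{-1}} .$$ Put $$S=q^{1/2}k-q^{-1/2}k^{-1}-(q^{1/2}+q^{-1/2})(q-q^{-1})fe,$$ $$C=qk^2+q^{-1}k^{-2}+(q-q^{-1})^2(qk+q^{-1}k^{-1})fe-(q-q^{-1})^2(q+2+q^{-1})f^2e^2 ,$$ and $F=f^L$, $E=e^L$, where $L$ is the smallest even multiple of $l$ (that is, $L=l$ if $l$ is even and $L=2l$ if $l$ is odd). Write $\mathbb C[k^l,k^{-l},C,F]$, $\mathbb C[k^l,k^{-l},C,E]$, $\mathbb C[k^l,k^{-l},C]$ for the subalgebras of $U$ generated by the displayed elements. Let $M=\mathbb C[k^l,k^{-l},C,F]+\mathbb C[k^l,k^{-l},C,E]$ be the sum of linear subspaces of $U$, and let $Z$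 be the centre of $U$ (the elements commuting with every element of $U$). Then: * the monomials $k^{la}C^bF^c$ ($a\in\mathbb Z$, $b,c\in\mathbb N$) are linearly independent, and so are the monomials $k^{la}C^bE^c$; thus $\mathbb C[k^l,k^{-l},C,F]$ and $\mathbb C[k^l,k^{-l},C,E]$ are Laurent polynomial in $k^l$ and polynomial in the other two elements; * $M\subseteq Z$, and $\mathbb C[k^l,k^{-l},C,F]\cap\mathbb C[k^l,k^{-l},C,E]=\mathbb C[k^l,k^{-l},C]$; * if $l$ is odd, then $Z=M$; * if $l$ is even, then $Z$ is free over $M$ with basis $1,k^{l/2}S$, in the sense that $k^{l/2}S\in Z$ and every $z\in Z$ can be written in exactly one way as $z=u+v\,k^{l/2}S$ with $u,v\in M$; if moreover $4\mid l$, then $M$ is a subalgebra of $Z$, and $Z$ is a free $M$-module with basis $1,k^{l/2}S$. -/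

import Mathlib

namespace UqOsp

/-- The four generators `e, f, k, k⁻¹`. -/
inductive Gen : Type
  | e | f | k | kinv

/-- A generator inside the free associative algebra. -/
abbrev gen (x : Gen) : FreeAlgebra ℂ Gen := FreeAlgebra.ι ℂ x

/-- The defining relations of `U_q(osp(1|2))`. -/
inductive Rel (q : ℂ) : FreeAlgebra ℂ Gen → FreeAlgebra ℂ Gen → Prop
  | k_kinv : Rel q (gen .k * gen .kinv) 1
  | kinv_k : Rel q (gen .kinv * gen .k) 1
  | k_e : Rel q (gen .k * gen .e * gen .kinv) (q • gen .e)
  | k_f : Rel q (gen .k * gen .f * gen .kinv) (q⁻¹ • gen .f)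
  | e_f : Rel q (gen .e * gen .f + gen .f * gen .e)
      ((q - q⁻¹)⁻¹ • (gen .k - gen .kinv))

/-- The unital associative complex algebra `U_q(osp(1|2))`, by generators and relations. -/
abbrev U (q : ℂ) : Type := RingQuot (Rel q)

/-- The image of a generator in `U_q(osp(1|2))`. -/
noncomputable def mk (q : ℂ) (x : Gen) : U q := RingQuot.mkAlgHom ℂ (Rel q) (gen x)

/-- The generator `e`. -/
noncomputable def e (q : ℂ) : U q := mk q .e

/-- The generator `f`. -/
noncomputable def f (q : ℂ) : U q := mk q .f

theorem k_mul_kinv (q : ℂ) : mk q .k * mk q .kinv = 1 := by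
  simpa [mk] using RingQuot.mkAlgHom_rel ℂ (Rel.k_kinv (q := q))

theorem kinv_mul_k (q : ℂ) : mk q .kinv * mk q .k = 1 := by
  simpa [mk] using RingQuot.mkAlgHom_rel ℂ (Rel.kinv_k (q := q))

/-- The generator `k`, as a unit whose inverse is the generator `k⁻¹`. -/
noncomputable def k (q : ℂ) : (U q)ˣ :=
  ⟨mk q .k, mk q .kinv, k_mul_kinv q, kinv_mul_k q⟩

theorem k_mul_e (q : ℂ) : (k q : U q) * e q * ((k q)⁻¹ : (U q)ˣ) = q • e q := by
  simpa [mk, k, e] using RingQuot.mkAlgHom_rel ℂ (Rel.k_e (q := q))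

theorem k_mul_f (q : ℂ) : (k q : U q) * f q * ((k q)⁻¹ : (U q)ˣ) = q⁻¹ • f q := by
  simpa [mk, k, f] using RingQuot.mkAlgHom_rel ℂ (Rel.k_f (q := q))

theorem e_mul_f (q : ℂ) : e q * f q + f q * e q =
    (q - q⁻¹)⁻¹ • ((k q : U q) - ((k q)⁻¹ : (U q)ˣ)) := by
  simpa [mk, k, e, f] using RingQuot.mkAlgHom_rel ℂ (Rel.e_f (q := q))

/-- The Scasimir operator `S = q^{1/2} k - q^{-1/2} k⁻¹ - η f e` with
`η = (q^{1/2} + q^{-1/2}) (q - q⁻¹)`; the argument `s` is the chosen square root of `q`. -/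
noncomputable def scasimir (q s : ℂ) : U q :=
  s • (k q : U q) - s⁻¹ • (((k q)⁻¹ : (U q)ˣ) : U q)
    - ((s + s⁻¹) * (q - q⁻¹)) • (f q * e q)

/-- The Casimir operator `C`. -/
noncomputable def casimir (q : ℂ) : U q :=
  q • ((k q ^ 2 : (U q)ˣ) : U q) + q⁻¹ • ((k q ^ (-2 : ℤ) : (U q)ˣ) : U q)
    + (q - q⁻¹) ^ 2 • ((q • (k q : U q) + q⁻¹ • (((k q)⁻¹ : (U q)ˣ) : U q)) * (f q * e q))
    - ((q - q⁻¹) ^ 2 * (q + 2 + q⁻¹)) • (f q ^ 2 * e q ^ 2)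

/-- The smallest even multiple of `l`. -/
def evenMult (l : ℕ) : ℕ := if Even l then l else 2 * l

/-- The element `F = f ^ L`. -/
noncomputable def F (q : ℂ) (l : ℕ) : U q := f q ^ evenMult l

/-- The element `E = e ^ L`. -/
noncomputable def E (q : ℂ) (l : ℕ) : U q := e q ^ evenMult l

/-- The subalgebra `ℂ[k^l, k^{-l}, C]`. -/
noncomputable def algC (q : ℂ) (l : ℕ) : Subalgebra ℂ (U q) :=
  Algebra.adjoin ℂ {((k q ^ (l : ℤ) : (U q)ˣ) : U q), ((k q ^ (-(l : ℤ)) : (U q)ˣ) : U q),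
    casimir q}

/-- The subalgebra `ℂ[k^l, k^{-l}, C, F]`. -/
noncomputable def algF (q : ℂ) (l : ℕ) : Subalgebra ℂ (U q) :=
  Algebra.adjoin ℂ {((k q ^ (l : ℤ) : (U q)ˣ) : U q), ((k q ^ (-(l : ℤ)) : (U q)ˣ) : U q),
    casimir q, F q l}

/-- The subalgebra `ℂ[k^l, k^{-l}, C, E]`. -/
noncomputable def algE (q : ℂ) (l : ℕ) : Subalgebra ℂ (U q) :=
  Algebra.adjoin ℂ {((k q ^ (l : ℤ) : (U q)ˣ) : U q), ((k q ^ (-(l : ℤ)) : (U q)ˣ) : U q),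
    casimir q, E q l}

/-- The sum `ℂ[k^l, k^{-l}, C, F] + ℂ[k^l, k^{-l}, C, E]` of linear subspaces. -/
noncomputable def sumFE (q : ℂ) (l : ℕ) : Submodule ℂ (U q) :=
  Subalgebra.toSubmodule (algF q l) ⊔ Subalgebra.toSubmodule (algE q l)

/-- The centre of `U_q(osp(1|2))`. -/
noncomputable abbrev centre (q : ℂ) : Subalgebra ℂ (U q) := Subalgebra.center ℂ (U q)

/-- The element `k^{l/2} S` (used for even `l`). -/
noncomputable def kS (q s : ℂ) (l : ℕ) : U q := ((k q ^ (l / 2) : (U q)ˣ) : U q) * scasimir q s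

end UqOsp

/-! Everything is read off a basis adapted to `S` instead of `C`. The Scasimir `S` commutes with `k`
and anticommutes with `e` and `f`, while `C = S² + 2`, and both `f e` and `e f` are linear
combinations of `k`, `k⁻¹` and `S`. Hence the monomials `k ^ n S ^ j X_d`, with `X_d = e ^ d` for `d
≥ 0` and `f ^ (-d)` for `d ≤ 0`, span `U` (`span_monomial`). They are independent because `U` acts
on sequences over `ℂ[t, t⁻¹, x]`, with `e` a shift, `k` acting as `q ^ i t` and `S` as `(-1) ^ i x`
(`linearIndependent_monomial`).

In this basis, commutation with `k` and with `S` is a diagonal condition: a central element involves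
only `d` with `q ^ d = 1` and `d` even, that is, `L ∣ d`. For such `d` the factor `X_d` is itself
central, and commutation with `e` then leaves exactly the monomials with `q ^ n = (-1) ^ j`
(`centre_eq`). The subalgebras in the theorem are also spanned by monomials, with `l ∣ n`, `j` even
and `d` in a prescribed set (`adjoin_union_eq_monoSpan`), so most claims become comparisons of index
sets. For odd `l` the condition `q ^ n = (-1) ^ j` forces `j` even and `l ∣ n`; for even `l` it also
allows odd `j` with `n` in `l/2 + lℤ`, and these monomials are the multiples of `k^{l/2} S`.

When `4 ∣ l`, closure of the sum under products reduces to `E F ∈ ℂ[k^l, k^{-l}, C]`. The element `E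
F` is a product of `l` factors in `ℂ[k, k⁻¹, S]`; the factors `i` and `i + l/2` multiply to an
expression in `S²` (`efWeight_mul`), and centrality of `E F` restricts the exponents of `k` to
multiples of `l`. -/

namespace UqOsp

/-! ### Elements commuting up to a scalar -/

section QCommutation

variable {A : Type*} [Ring A] [Algebra ℂ A] {c : ℂ} {x y : A}

theorem mul_pow_of_qcomm (h : x * y = c • (y * x)) (n : ℕ) :
    x * y ^ n = c ^ n • (y ^ n * x) := by
  induction n with
  | zero => simp
  | succ n ih =>
    rw [pow_succ, ← mul_assoc, ih, smul_mul_assoc, mul_assoc, h, mul_smul_comm, smul_smul,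
      ← mul_assoc, pow_succ]

theorem pow_mul_of_qcomm (h : x * y = c • (y * x)) (n : ℕ) :
    x ^ n * y = c ^ n • (y * x ^ n) := by
  induction n with
  | zero => simp
  | succ n ih =>
    rw [pow_succ, mul_assoc, h, mul_smul_comm, ← mul_assoc, ih, smul_mul_assoc, smul_smul,
      mul_assoc, pow_succ, mul_comm c]

theorem mul_inv_of_qcomm {u : Aˣ} (hc : c ≠ 0) (h : x * u = c • (u * x)) :
    x * ((u⁻¹ : Aˣ) : A) = c⁻¹ • (((u⁻¹ : Aˣ) : A) * x) := by
  have h2 : ((u⁻¹ : Aˣ) : A) * (x * u) * ((u⁻¹ : Aˣ) : A) =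
      c • (((u⁻¹ : Aˣ) : A) * (u * x) * ((u⁻¹ : Aˣ) : A)) := by
    rw [h, mul_smul_comm, smul_mul_assoc]
  rw [mul_assoc, mul_assoc x, Units.mul_inv, mul_one, ← mul_assoc _ (u : A), Units.inv_mul,
    one_mul] at h2
  rw [h2, smul_smul, inv_mul_cancel₀ hc, one_smul]

theorem mul_zpow_of_qcomm {u : Aˣ} (hc : c ≠ 0) (h : x * u = c • (u * x)) (n : ℤ) :
    x * ((u ^ n : Aˣ) : A) = c ^ n • (((u ^ n : Aˣ) : A) * x) := by
  cases n with
  | ofNat n => simpa using mul_pow_of_qcomm h n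
  | negSucc n =>
    have h2 := mul_inv_of_qcomm (pow_ne_zero (n + 1) hc)
      (u := u ^ (n + 1)) (by simpa using mul_pow_of_qcomm h (n + 1))
    rwa [zpow_negSucc, zpow_negSucc]

end QCommutation

/-- The integral powers of `k`, as elements of `U`. -/
noncomputable abbrev kz (q : ℂ) (n : ℤ) : U q := ((k q ^ n : (U q)ˣ) : U q)

/-! ### Commutation rules for `S`, and its relation to `C`, `f e` and `e f` -/

section Relations

variable {q s : ℂ}

theorem kz_add (m n : ℤ) : kz q (m + n) = kz q m * kz q n := by
  rw [kz, zpow_add, Units.val_mul]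

theorem kz_zero : kz q 0 = 1 := by simp [kz]

theorem kz_one : kz q 1 = (k q : U q) := by simp [kz]

theorem kz_neg_one : kz q (-1) = (((k q)⁻¹ : (U q)ˣ) : U q) := by simp [kz]

theorem e_mul_k (h0 : q ≠ 0) : e q * k q = q⁻¹ • ((k q : U q) * e q) := by
  have h : (k q : U q) * e q = q • (e q * k q) := by
    rw [← smul_mul_assoc, ← k_mul_e]; simp [mul_assoc]
  rw [h, smul_smul, inv_mul_cancel₀ h0, one_smul]

theorem f_mul_k (h0 : q ≠ 0) : f q * k q = q • ((k q : U q) * f q) := by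
  have h : (k q : U q) * f q = q⁻¹ • (f q * k q) := by
    rw [← smul_mul_assoc, ← k_mul_f]; simp [mul_assoc]
  rw [h, smul_smul, mul_inv_cancel₀ h0, one_smul]

theorem e_mul_kz (h0 : q ≠ 0) (n : ℤ) : e q * kz q n = (q ^ n)⁻¹ • (kz q n * e q) := by
  rw [mul_zpow_of_qcomm (inv_ne_zero h0) (e_mul_k h0), inv_zpow]

theorem f_mul_kz (h0 : q ≠ 0) (n : ℤ) : f q * kz q n = q ^ n • (kz q n * f q) :=
  mul_zpow_of_qcomm h0 (f_mul_k h0) n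

/-- The coefficient of `f e` in `- S`. -/
noncomputable def eta (q s : ℂ) : ℂ := (s + s⁻¹) * (q - q⁻¹)

theorem sub_inv_ne_zero' (h0 : q ≠ 0) (h1 : q ^ 2 ≠ 1) : q - q⁻¹ ≠ 0 := by
  intro h
  apply h1
  field_simp at h
  linear_combination h

theorem eta_ne_zero (hs : s ^ 2 = q) (h0 : q ≠ 0) (h1 : q ^ 2 ≠ 1) : eta q s ≠ 0 := by
  refine mul_ne_zero ?_ (sub_inv_ne_zero' h0 h1)
  have hs0 : s ≠ 0 := by rintro rfl; exact h0 (by simpa using hs.symm)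
  intro h
  field_simp at h
  exact h1 (by linear_combination (q - 1) * h - (q - 1) * hs)

theorem kz_mul_scasimir (h0 : q ≠ 0) (n : ℤ) :
    kz q n * scasimir q s = scasimir q s * kz q n := by
  have hk : kz q n * k q = k q * kz q n := by rw [← kz_one, ← kz_add, ← kz_add, add_comm]
  have hk' : kz q n * (((k q)⁻¹ : (U q)ˣ) : U q) = (((k q)⁻¹ : (U q)ˣ) : U q) * kz q n := by
    rw [← kz_neg_one, ← kz_add, ← kz_add, add_comm]
  have hfe : kz q n * (f q * e q) = f q * e q * kz q n := by
    rw [mul_assoc (f q), e_mul_kz h0, mul_smul_comm, ← mul_assoc, ← mul_assoc, f_mul_kz h0,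
      smul_mul_assoc, smul_smul, inv_mul_cancel₀ (zpow_ne_zero n h0), one_smul]
  simp only [scasimir, mul_sub, sub_mul, mul_smul_comm, smul_mul_assoc, hk, hk', hfe]

theorem e_mul_f' : e q * f q =
    (q - q⁻¹)⁻¹ • ((k q : U q) - ((k q)⁻¹ : (U q)ˣ)) - f q * e q := by
  rw [← e_mul_f]; abel

theorem e_mul_kinv (h0 : q ≠ 0) :
    e q * (((k q)⁻¹ : (U q)ˣ) : U q) = q • ((((k q)⁻¹ : (U q)ˣ) : U q) * e q) := by
  simpa [kz] using e_mul_kz h0 (-1)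

theorem f_mul_kinv (h0 : q ≠ 0) :
    f q * (((k q)⁻¹ : (U q)ˣ) : U q) = q⁻¹ • ((((k q)⁻¹ : (U q)ˣ) : U q) * f q) := by
  simpa [kz] using f_mul_kz h0 (-1)

theorem mul_assoc_of_eq {A : Type*} [Semigroup A] {a b c : A} (h : a * b = c) (x : A) :
    a * (b * x) = c * x := by rw [← mul_assoc, h]

theorem e_mul_scasimir (hs : s ^ 2 = q) (h0 : q ≠ 0) (h1 : q ^ 2 ≠ 1) :
    e q * scasimir q s = -(scasimir q s * e q) := by
  have hs0 : s ≠ 0 := by rintro rfl; exact h0 (by simpa using hs.symm)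
  have hq' := sub_inv_ne_zero' h0 h1
  have hq2 : q ^ 2 - 1 ≠ 0 := sub_ne_zero.2 h1
  -- Both sides are brought to the normal order `k`, `f`, `e`, where they are combinations of `k e`,
  -- `k⁻¹ e` and `f e e`.
  simp only [scasimir, mul_sub, sub_mul, mul_smul_comm, smul_mul_assoc, mul_assoc,
    e_mul_k h0, e_mul_kinv h0, mul_assoc_of_eq (e_mul_f' (q := q)), smul_sub]
  -- With `q` replaced by `s ^ 2`, the coefficients are rational functions of `s` alone.
  subst hs
  have hs4 : s ^ 4 - 1 ≠ 0 := by rwa [← pow_mul] at hq2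
  match_scalars <;> field_simp <;> ring

theorem f_mul_scasimir (hs : s ^ 2 = q) (h0 : q ≠ 0) (h1 : q ^ 2 ≠ 1) :
    f q * scasimir q s = -(scasimir q s * f q) := by
  have hs0 : s ≠ 0 := by rintro rfl; exact h0 (by simpa using hs.symm)
  have hq' := sub_inv_ne_zero' h0 h1
  have hq2 : q ^ 2 - 1 ≠ 0 := sub_ne_zero.2 h1
  simp only [scasimir, mul_sub, sub_mul, mul_smul_comm, smul_mul_assoc, mul_assoc,
    f_mul_k h0, f_mul_kinv h0, e_mul_f', smul_sub]
  subst hs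
  have hs4 : s ^ 4 - 1 ≠ 0 := by rwa [← pow_mul] at hq2
  match_scalars <;> field_simp <;> ring

theorem f_mul_e (hs : s ^ 2 = q) (h0 : q ≠ 0) (h1 : q ^ 2 ≠ 1) :
    f q * e q = (eta q s)⁻¹ • (s • kz q 1 - s⁻¹ • kz q (-1) - scasimir q s) := by
  have := eta_ne_zero hs h0 h1
  rw [kz_one, kz_neg_one, scasimir, ← eta, sub_sub_cancel, smul_smul, inv_mul_cancel₀ this,
    one_smul]

theorem e_mul_f_eq (hs : s ^ 2 = q) (h0 : q ≠ 0) (h1 : q ^ 2 ≠ 1) :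
    e q * f q = (eta q s)⁻¹ • (s⁻¹ • kz q 1 - s • kz q (-1) + scasimir q s) := by
  have hs0 : s ≠ 0 := by rintro rfl; exact h0 (by simpa using hs.symm)
  have hη := eta_ne_zero hs h0 h1
  rw [e_mul_f', f_mul_e hs h0 h1, kz_one, kz_neg_one]
  have h : (q - q⁻¹)⁻¹ = (eta q s)⁻¹ * (s + s⁻¹) := by
    rw [eta] at hη ⊢
    have h2 := left_ne_zero_of_mul hη
    rw [mul_inv, mul_right_comm, inv_mul_cancel₀ h2, one_mul]
  rw [h]
  module

theorem casimir_eq (hs : s ^ 2 = q) (h0 : q ≠ 0) (h1 : q ^ 2 ≠ 1) :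
    casimir q = scasimir q s ^ 2 + algebraMap ℂ (U q) 2 := by
  have hs0 : s ≠ 0 := by rintro rfl; exact h0 (by simpa using hs.symm)
  have hq' := sub_inv_ne_zero' h0 h1
  have hk2' : ((k q ^ (-2 : ℤ) : (U q)ˣ) : U q) =
    (((k q)⁻¹ : (U q)ˣ) : U q) * (((k q)⁻¹ : (U q)ˣ) : U q) := by
    rw [show (-2 : ℤ) = -1 + -1 by rfl]
    simpa only [kz_neg_one] using kz_add (q := q) (-1) (-1)
  simp only [casimir, scasimir, hk2', pow_two, Algebra.algebraMap_eq_smul_one,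
    mul_sub, sub_mul, mul_add, add_mul, mul_smul_comm, smul_mul_assoc, mul_assoc,
    e_mul_k h0, e_mul_kinv h0, mul_assoc_of_eq (f_mul_k h0),
    mul_assoc_of_eq (f_mul_kinv h0), mul_assoc_of_eq (e_mul_f' (q := q)), smul_sub,
    Units.mul_inv, Units.inv_mul]
  subst hs
  match_scalars <;> field_simp <;> ring

end Relations

/-! ### A representation on sequences, and independence of the monomials -/

section Representation

/-- The commutative Laurent polynomial algebra `ℂ[t, t⁻¹, x]`. -/
abbrev Coef : Type := AddMonoidAlgebra ℂ (ℤ × ℕ)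

/-- The monomial `t ^ n x ^ j`. -/
noncomputable def mono (n : ℤ) (j : ℕ) : Coef := AddMonoidAlgebra.single (n, j) 1

theorem mono_mul_mono (m n : ℤ) (i j : ℕ) : mono m i * mono n j = mono (m + n) (i + j) := by
  simp [mono, AddMonoidAlgebra.single_mul_single]

theorem mono_zero : mono 0 0 = 1 := rfl

/-- The matrix coefficients of `f`. -/
noncomputable def fWeight (q s : ℂ) (i : ℤ) : Coef :=
  (eta q s)⁻¹ • ((s * q ^ i) • mono 1 0 - (s * q ^ i)⁻¹ • mono (-1) 0 - (-1 : ℂ) ^ i • mono 0 1)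

/-- The images of the generators as operators on sequences. -/
noncomputable def repGen (q s : ℂ) : Gen → Module.End ℂ (ℤ → Coef)
  | .e => LinearMap.funLeft ℂ Coef (fun i : ℤ => i - 1)
  | .f => LinearMap.mulLeft ℂ (fWeight q s) ∘ₗ LinearMap.funLeft ℂ Coef (fun i : ℤ => i + 1)
  | .k => LinearMap.mulLeft ℂ (fun i : ℤ => q ^ i • mono 1 0)
  | .kinv => LinearMap.mulLeft ℂ (fun i : ℤ => (q ^ i)⁻¹ • mono (-1) 0)

variable {q s : ℂ}

/-- This is the relation for `e f + f e` at position `i`; the terms in `x` cancel because their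
signs alternate. -/
theorem fWeight_add (hs : s ^ 2 = q) (h0 : q ≠ 0) (h1 : q ^ 2 ≠ 1) (i : ℤ) :
    fWeight q s (i - 1) + fWeight q s i =
      (q - q⁻¹)⁻¹ • (q ^ i • mono 1 0 - (q ^ i)⁻¹ • mono (-1) 0) := by
  have hs0 : s ≠ 0 := by rintro rfl; exact h0 (by simpa using hs.symm)
  have hη := eta_ne_zero hs h0 h1
  have h : (q - q⁻¹)⁻¹ = (eta q s)⁻¹ * (s + s⁻¹) := by
    rw [eta] at hη ⊢
    rw [mul_inv, mul_right_comm, inv_mul_cancel₀ (left_ne_zero_of_mul hη), one_mul]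
  have hqi : q ^ i ≠ 0 := zpow_ne_zero i h0
  rw [h, fWeight, fWeight, ← smul_add, mul_smul (eta q s)⁻¹, zpow_sub_one₀ h0,
    zpow_sub_one₀ (by norm_num)]
  congr 1
  subst hs
  match_scalars
  · field_simp
    ring
  · field_simp
    ring
  · ring

theorem repGen_rel (hs : s ^ 2 = q) (h0 : q ≠ 0) (h1 : q ^ 2 ≠ 1) ⦃x y : FreeAlgebra ℂ Gen⦄
    (h : Rel q x y) :
    FreeAlgebra.lift ℂ (repGen q s) x = FreeAlgebra.lift ℂ (repGen q s) y := by
  have hqi : ∀ i : ℤ, q ^ i ≠ 0 := fun i => zpow_ne_zero i h0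
  have hm : ∀ p, mono 1 0 * (mono (-1) 0 * p) = p := fun p => by
    rw [← mul_assoc, mono_mul_mono]; exact one_mul p
  have hm' : ∀ p, mono (-1) 0 * (mono 1 0 * p) = p := fun p => by
    rw [← mul_assoc, mono_mul_mono]; exact one_mul p
  cases h <;> refine LinearMap.ext fun v => funext fun i => ?_ <;>
    simp only [map_mul, map_add, map_sub, map_smul, map_one, FreeAlgebra.lift_ι_apply, repGen,
      Module.End.mul_apply, LinearMap.mulLeft_apply, LinearMap.funLeft_apply, Pi.mul_apply,
      LinearMap.coe_comp, Function.comp_apply, Module.End.one_apply, LinearMap.smul_apply,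
      LinearMap.add_apply, LinearMap.sub_apply, Pi.smul_apply, Pi.add_apply, Pi.sub_apply,
      smul_mul_assoc, mul_smul_comm, smul_smul]
  · rw [hm, inv_mul_cancel₀ (hqi i), one_smul]
  · rw [hm', mul_inv_cancel₀ (hqi i), one_smul]
  · rw [hm, zpow_sub_one₀ h0, mul_inv, inv_inv, mul_right_comm, inv_mul_cancel₀ (hqi _), one_mul]
  · rw [mul_left_comm, hm, zpow_add_one₀ h0, mul_inv, mul_right_comm,
      inv_mul_cancel₀ (hqi _), one_mul]
  · rw [sub_add_cancel, add_sub_cancel_right, ← add_mul, fWeight_add hs h0 h1, smul_mul_assoc,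
      sub_mul, smul_mul_assoc, smul_mul_assoc]

/-- The representation of `U` on sequences. -/
noncomputable def rep (hs : s ^ 2 = q) (h0 : q ≠ 0) (h1 : q ^ 2 ≠ 1) :
    U q →ₐ[ℂ] Module.End ℂ (ℤ → Coef) :=
  RingQuot.liftAlgHom ℂ ⟨FreeAlgebra.lift ℂ (repGen q s), repGen_rel hs h0 h1⟩

variable (hs : s ^ 2 = q) (h0 : q ≠ 0) (h1 : q ^ 2 ≠ 1) (v : ℤ → Coef) (i : ℤ)

theorem rep_mk (x : Gen) : rep hs h0 h1 (mk q x) = repGen q s x := by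
  rw [rep, mk, RingQuot.liftAlgHom_mkAlgHom_apply, FreeAlgebra.lift_ι_apply]

theorem rep_e : rep hs h0 h1 (e q) v i = v (i - 1) := by
  rw [e, rep_mk]; rfl

theorem rep_f : rep hs h0 h1 (f q) v i = fWeight q s i * v (i + 1) := by
  rw [f, rep_mk]; rfl

theorem rep_kz_one : rep hs h0 h1 (kz q 1) v i = q ^ i • mono 1 0 * v i := by
  rw [kz_one, k, Units.val_mk, rep_mk]; rfl

theorem rep_kz_neg_one : rep hs h0 h1 (kz q (-1)) v i = (q ^ i)⁻¹ • mono (-1) 0 * v i := by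
  rw [kz_neg_one, k, Units.inv_mk, Units.val_mk, rep_mk]; rfl

theorem rep_kz (n : ℤ) : rep hs h0 h1 (kz q n) v i = (q ^ i) ^ n • mono n 0 * v i := by
  have hqi : q ^ i ≠ 0 := zpow_ne_zero i h0
  induction n using Int.induction_on with
  | zero => rw [kz_zero, map_one, zpow_zero, one_smul, mono_zero, one_mul]; rfl
  | succ n ih =>
    rw [add_comm, kz_add, map_mul, Module.End.mul_apply, rep_kz_one, ih, ← mul_assoc,
      smul_mul_smul_comm, mono_mul_mono, zpow_one_add₀ hqi]
  | pred n ih =>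
    rw [sub_eq_add_neg, add_comm, kz_add, map_mul, Module.End.mul_apply, rep_kz_neg_one, ih,
      ← mul_assoc, smul_mul_smul_comm, mono_mul_mono, zpow_add₀ hqi, zpow_neg_one]

theorem rep_scasimir : rep hs h0 h1 (scasimir q s) v i = (-1 : ℂ) ^ i • mono 0 1 * v i := by
  have hη := eta_ne_zero hs h0 h1
  have h : scasimir q s = s • kz q 1 - s⁻¹ • kz q (-1) - eta q s • (f q * e q) := by
    rw [kz_one, kz_neg_one, scasimir, eta]
  rw [h]
  simp only [map_sub, map_smul, map_mul, LinearMap.sub_apply, LinearMap.smul_apply,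
    Module.End.mul_apply, Pi.sub_apply, Pi.smul_apply, rep_kz_one, rep_kz_neg_one, rep_f, rep_e,
    add_sub_cancel_right, fWeight, ← smul_mul_assoc, smul_smul, mul_inv_cancel₀ hη, one_smul,
    ← sub_mul, mul_inv]
  congr 1
  abel

theorem rep_scasimir_pow (j : ℕ) :
    rep hs h0 h1 (scasimir q s ^ j) v i = ((-1 : ℂ) ^ i) ^ j • mono 0 j * v i := by
  induction j with
  | zero => rw [pow_zero, map_one, pow_zero, one_smul, mono_zero, one_mul]; rfl
  | succ j ih =>
    rw [pow_succ', map_mul, Module.End.mul_apply, rep_scasimir, ih, ← mul_assoc,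
      smul_mul_smul_comm, mono_mul_mono, pow_succ', add_comm j, add_zero]

theorem rep_e_single (d : ℤ) (w : Coef) :
    rep hs h0 h1 (e q) (Pi.single d w) = Pi.single (d + 1) w := by
  ext1 i
  rw [rep_e]
  by_cases h : i = d + 1
  · subst h; simp
  · rw [Pi.single_eq_of_ne h, Pi.single_eq_of_ne (by omega)]

theorem rep_f_single (d : ℤ) (w : Coef) :
    rep hs h0 h1 (f q) (Pi.single d w) = Pi.single (d - 1) (fWeight q s (d - 1) * w) := by
  ext1 i
  rw [rep_f]
  by_cases h : i = d - 1
  · subst h; simp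
  · rw [Pi.single_eq_of_ne h, Pi.single_eq_of_ne (by omega), mul_zero]

include hs h0 h1 in
theorem fWeight_ne_zero : fWeight q s i ≠ 0 := by
  refine smul_ne_zero (inv_ne_zero (eta_ne_zero hs h0 h1)) fun h => ?_
  -- The coefficient of `x` is a sign, hence nonzero.
  have := congrArg (fun p : Coef => p.coeff (0, 1)) h
  exact zpow_ne_zero i (neg_ne_zero.2 one_ne_zero) (by simpa [mono] using this)

/-- `e ^ d` for `d ≥ 0`, and `f ^ (-d)` for `d ≤ 0`. -/
noncomputable def efPow (q : ℂ) (d : ℤ) : U q := e q ^ d.toNat * f q ^ (-d).toNat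

theorem efPow_natCast (n : ℕ) : efPow q n = e q ^ n := by simp [efPow]

theorem efPow_neg_natCast (n : ℕ) : efPow q (-n) = f q ^ n := by simp [efPow]

theorem rep_efPow (d : ℤ) :
    ∃ w : Coef, w ≠ 0 ∧ rep hs h0 h1 (efPow q d) (Pi.single 0 1) = Pi.single d w := by
  obtain ⟨n, rfl | rfl⟩ := d.eq_nat_or_neg
  · rw [efPow_natCast]
    induction n with
    | zero => exact ⟨1, one_ne_zero, by simp⟩
    | succ n ih =>
      obtain ⟨w, hw, h⟩ := ih
      refine ⟨w, hw, ?_⟩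
      rw [pow_succ', map_mul, Module.End.mul_apply, h, rep_e_single, Nat.cast_succ]
  · rw [efPow_neg_natCast]
    induction n with
    | zero => exact ⟨1, one_ne_zero, by simp⟩
    | succ n ih =>
      obtain ⟨w, hw, h⟩ := ih
      refine ⟨_, mul_ne_zero (fWeight_ne_zero hs h0 h1 (-(n : ℤ) - 1)) hw, ?_⟩
      rw [pow_succ', map_mul, Module.End.mul_apply, h, rep_f_single, Nat.cast_succ, neg_add,
        ← sub_eq_add_neg]

/-- The monomials `k ^ n S ^ j e ^ d` and `k ^ n S ^ j f ^ d`, indexed by `(± d, n, j)`. -/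
noncomputable def monomial (q s : ℂ) (m : ℤ × ℤ × ℕ) : U q :=
  kz q m.2.1 * scasimir q s ^ m.2.2 * efPow q m.1

/-- Applied to the sequence supported at `0` with value `1`, the monomial of index `(d, n, j)` gives
a nonzero scalar times `t ^ n x ^ j w_d` placed at position `d`. Different `d` are separated by
position, and for fixed `d` multiplication by `w_d ≠ 0` is injective in the domain `Coef`. -/
theorem linearIndependent_rep_monomial :
    LinearIndependent ℂ
      (fun m : ℤ × ℤ × ℕ => rep hs h0 h1 (monomial q s m) (Pi.single 0 1)) := by
  choose w hw hw' using rep_efPow hs h0 h1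
  have hc : ∀ m : ℤ × ℤ × ℕ, (q ^ m.1) ^ m.2.1 * ((-1 : ℂ) ^ m.1) ^ m.2.2 ≠ 0 := fun m =>
    mul_ne_zero (zpow_ne_zero _ (zpow_ne_zero _ h0))
      (pow_ne_zero _ (zpow_ne_zero _ (neg_ne_zero.2 one_ne_zero)))
  have key : (fun m : ℤ × ℤ × ℕ => rep hs h0 h1 (monomial q s m) (Pi.single 0 1)) =
      (fun m => Units.mk0 _ (hc m)) • (fun m : ℤ × ℤ × ℕ =>
        (Pi.single m.1 (mono m.2.1 m.2.2 * w m.1) : ℤ → Coef)) := by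
    ext1 ⟨d, n, j⟩
    ext1 i
    simp only [monomial, map_mul, Module.End.mul_apply, hw', rep_kz, rep_scasimir_pow,
      Pi.smul_apply', Units.smul_mk0, Pi.smul_apply]
    by_cases h : i = d
    · subst h
      rw [Pi.single_eq_same, Pi.single_eq_same, ← mul_assoc, smul_mul_smul_comm, mono_mul_mono,
        add_zero, zero_add, smul_mul_assoc]
    · simp [Pi.single_eq_of_ne h]
  rw [key]
  refine LinearIndependent.units_smul ?_ _
  have h := Pi.linearIndependent_single (R := ℂ) (Ms := fun _ : ℤ => Coef)
    (fun (d : ℤ) (p : ℤ × ℕ) => mono p.1 p.2 * w d) fun d => by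
      have hb : LinearIndependent ℂ (fun p : ℤ × ℕ => mono p.1 p.2) := by
        convert (AddMonoidAlgebra.basis (ℤ × ℕ) ℂ).linearIndependent using 1
        ext1 p
        simp [mono]
      refine hb.map' (LinearMap.mulRight ℂ (w d)) (LinearMap.ker_eq_bot'.2 fun p hp => ?_)
      exact (mul_eq_zero.1 hp).resolve_right (hw d)
  exact (linearIndependent_equiv (Equiv.sigmaEquivProd ℤ (ℤ × ℕ))).1 h

include hs h0 h1 in
theorem linearIndependent_monomial : LinearIndependent ℂ (monomial q s) :=
  LinearIndependent.of_comp (LinearMap.applyₗ (Pi.single 0 1) ∘ₗ (rep hs h0 h1).toLinearMap)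
    (linearIndependent_rep_monomial hs h0 h1)

end Representation

/-! ### Spanning by monomials, and faithfulness of the representation -/

section Spanning

theorem adjoin_le_of_mul_mem {A : Type*} [Ring A] [Algebra ℂ A] {G : Set A} {N : Submodule ℂ A}
    (h1 : 1 ∈ N) (hG : ∀ g ∈ G, ∀ n ∈ N, g * n ∈ N) :
    Subalgebra.toSubmodule (Algebra.adjoin ℂ G) ≤ N := by
  have key : ∀ a ∈ Algebra.adjoin ℂ G, ∀ n ∈ N, a * n ∈ N := fun a ha => by
    induction ha using Algebra.adjoin_induction with
    | mem g hg => exact hG g hg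
    | algebraMap r => intro n hn; rw [← Algebra.smul_def]; exact N.smul_mem r hn
    | add x y _ _ hx hy => intro n hn; rw [add_mul]; exact N.add_mem (hx n hn) (hy n hn)
    | mul x y _ _ hx hy => intro n hn; rw [mul_assoc]; exact hx _ (hy n hn)
  intro a ha
  simpa using key a ha 1 h1

theorem mul_mem_span {A : Type*} [Ring A] [Algebra ℂ A] {G : Set A} {N : Submodule ℂ A} {g : A}
    (hg : ∀ x ∈ G, g * x ∈ N) : ∀ n ∈ Submodule.span ℂ G, g * n ∈ N := fun _ hn =>
  (Submodule.span_le (p := N.comap (LinearMap.mulLeft ℂ g))).2 hg hn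

theorem adjoin_gen (q : ℂ) : Algebra.adjoin ℂ (Set.range (mk q)) = ⊤ := by
  have h : Set.range (mk q) = RingQuot.mkAlgHom ℂ (Rel q) '' Set.range (FreeAlgebra.ι ℂ) := by
    rw [← Set.range_comp]; rfl
  rw [h, ← AlgHom.map_adjoin, FreeAlgebra.adjoin_range_ι, Algebra.map_top,
    AlgHom.range_eq_top]
  exact RingQuot.mkAlgHom_surjective ℂ (Rel q)

theorem mk_k (q : ℂ) : mk q .k = kz q 1 := by rw [kz_one]; rfl

theorem mk_kinv (q : ℂ) : mk q .kinv = kz q (-1) := by rw [kz_neg_one]; rfl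

theorem mem_centre_of_commute {q : ℂ} {z : U q} (he : e q * z = z * e q)
    (hf : f q * z = z * f q) (hk : kz q 1 * z = z * kz q 1) : z ∈ centre q := by
  have hkinv : kz q (-1) * z = z * kz q (-1) := by
    rw [kz_one] at hk
    rw [kz_neg_one]
    exact Commute.units_inv_left hk
  have h : Algebra.adjoin ℂ (Set.range (mk q)) ≤ Subalgebra.centralizer ℂ {z} := by
    refine Algebra.adjoin_le ?_
    rintro _ ⟨x, rfl⟩
    simp only [Subalgebra.coe_centralizer, Set.mem_centralizer_iff, Set.mem_singleton_iff,
      forall_eq]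
    cases x
    · exact he.symm
    · exact hf.symm
    · rw [mk_k]; exact hk.symm
    · rw [mk_kinv]; exact hkinv.symm
  rw [adjoin_gen] at h
  rw [Subalgebra.mem_center_iff]
  intro b
  exact ((Subalgebra.mem_centralizer_iff ℂ).1 (h (Algebra.mem_top (x := b))) z rfl).symm

variable {q s : ℂ}

theorem scasimir_pow_mul_kz (h0 : q ≠ 0) (n : ℤ) (j : ℕ) :
    scasimir q s ^ j * kz q n = kz q n * scasimir q s ^ j :=
  (Commute.pow_right (kz_mul_scasimir h0 n) j).symm

theorem kz_mul_monomial (n : ℤ) (m : ℤ × ℤ × ℕ) :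
    kz q n * monomial q s m = monomial q s (m.1, n + m.2.1, m.2.2) := by
  simp only [monomial, kz_add, mul_assoc]

theorem scasimir_mul_monomial (h0 : q ≠ 0) (m : ℤ × ℤ × ℕ) :
    scasimir q s * monomial q s m = monomial q s (m.1, m.2.1, m.2.2 + 1) := by
  simp only [monomial, pow_succ', ← mul_assoc, kz_mul_scasimir h0]

theorem casimir_mul_monomial (hs : s ^ 2 = q) (h0 : q ≠ 0) (h1 : q ^ 2 ≠ 1) (m : ℤ × ℤ × ℕ) :
    casimir q * monomial q s m =
      monomial q s (m.1, m.2.1, m.2.2 + 2) + (2 : ℂ) • monomial q s m := by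
  rw [casimir_eq hs h0 h1, add_mul, ← Algebra.smul_def, pow_two, mul_assoc,
    scasimir_mul_monomial h0, scasimir_mul_monomial h0]

theorem kz_mul_scasimir_pow_mul_mem_span (h0 : q ≠ 0) {x : U q} (n : ℤ) (j : ℕ)
    (hx : x ∈ Submodule.span ℂ (Set.range (monomial q s))) :
    kz q n * scasimir q s ^ j * x ∈ Submodule.span ℂ (Set.range (monomial q s)) := by
  rw [mul_assoc]
  have hk : ∀ y ∈ Submodule.span ℂ (Set.range (monomial q s)),
      kz q n * y ∈ Submodule.span ℂ (Set.range (monomial q s)) := by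
    refine mul_mem_span ?_
    rintro _ ⟨m, rfl⟩
    rw [kz_mul_monomial]
    exact Submodule.subset_span ⟨_, rfl⟩
  have hS : ∀ y ∈ Submodule.span ℂ (Set.range (monomial q s)),
      scasimir q s * y ∈ Submodule.span ℂ (Set.range (monomial q s)) := by
    refine mul_mem_span ?_
    rintro _ ⟨m, rfl⟩
    rw [scasimir_mul_monomial h0]
    exact Submodule.subset_span ⟨_, rfl⟩
  refine hk _ ?_
  induction j with
  | zero => simpa using hx
  | succ j ih => rw [pow_succ', mul_assoc]; exact hS _ ih

theorem efPow_mem_span (d : ℤ) :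
    efPow q d ∈ Submodule.span ℂ (Set.range (monomial q s)) := by
  refine Submodule.subset_span ⟨(d, 0, 0), ?_⟩
  rw [monomial, kz_zero, pow_zero, one_mul, one_mul]

/-- The left factor has the shape of `f e` and, up to signs of the constants, of `e f`; this covers
the case where a generator cancels against a power of the opposite one. -/
theorem mul_efPow_mem_span (h0 : q ≠ 0) (a b c : ℂ) (d : ℤ) :
    (a • (b • kz q 1 - c • kz q (-1) - scasimir q s)) * efPow q d ∈
      Submodule.span ℂ (Set.range (monomial q s)) := by
  have h := efPow_mem_span (q := q) (s := s) d
  have hk1 := kz_mul_scasimir_pow_mul_mem_span h0 1 0 h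
  have hk2 := kz_mul_scasimir_pow_mul_mem_span h0 (-1) 0 h
  have hk3 := kz_mul_scasimir_pow_mul_mem_span h0 0 1 h
  rw [pow_zero, mul_one] at hk1 hk2
  rw [kz_zero, pow_one, one_mul] at hk3
  simp only [smul_mul_assoc, sub_mul]
  exact Submodule.smul_mem _ _ (Submodule.sub_mem _ (Submodule.sub_mem _
    (Submodule.smul_mem _ _ hk1) (Submodule.smul_mem _ _ hk2)) hk3)

section

variable (hs : s ^ 2 = q) (h0 : q ≠ 0) (h1 : q ^ 2 ≠ 1)
include hs h0 h1

theorem e_mul_scasimir_pow (j : ℕ) :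
    e q * scasimir q s ^ j = (-1 : ℂ) ^ j • (scasimir q s ^ j * e q) :=
  mul_pow_of_qcomm (by rw [e_mul_scasimir hs h0 h1]; module) j

theorem f_mul_scasimir_pow (j : ℕ) :
    f q * scasimir q s ^ j = (-1 : ℂ) ^ j • (scasimir q s ^ j * f q) :=
  mul_pow_of_qcomm (by rw [f_mul_scasimir hs h0 h1]; module) j

theorem e_mul_kz_mul_scasimir_pow (n : ℤ) (j : ℕ) :
    e q * (kz q n * scasimir q s ^ j) =
      ((q ^ n)⁻¹ * (-1) ^ j) • (kz q n * scasimir q s ^ j * e q) := by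
  rw [← mul_assoc, e_mul_kz h0, smul_mul_assoc, mul_assoc, e_mul_scasimir_pow hs h0 h1,
    mul_smul_comm, smul_smul, mul_assoc]

theorem f_mul_kz_mul_scasimir_pow (n : ℤ) (j : ℕ) :
    f q * (kz q n * scasimir q s ^ j) =
      (q ^ n * (-1) ^ j) • (kz q n * scasimir q s ^ j * f q) := by
  rw [← mul_assoc, f_mul_kz h0, smul_mul_assoc, mul_assoc, f_mul_scasimir_pow hs h0 h1,
    mul_smul_comm, smul_smul, mul_assoc]

theorem e_mul_efPow_mem_span (d : ℤ) :
    e q * efPow q d ∈ Submodule.span ℂ (Set.range (monomial q s)) := by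
  have hpos : ∀ n : ℕ, e q * efPow q n ∈ Submodule.span ℂ (Set.range (monomial q s)) := by
    intro n
    rw [efPow_natCast, ← pow_succ', ← efPow_natCast]
    exact efPow_mem_span _
  obtain ⟨n, rfl | rfl⟩ := d.eq_nat_or_neg
  · exact hpos n
  · cases n with
    | zero => simpa using hpos 0
    | succ n =>
      rw [efPow_neg_natCast, pow_succ', ← mul_assoc, e_mul_f_eq hs h0 h1, ← efPow_neg_natCast]
      -- In `e f` the term `S` has the opposite sign, so all three constants are negated.
      have := mul_efPow_mem_span (s := s) h0 (-(eta q s)⁻¹) (-s⁻¹) (-s) (-(n : ℤ))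
      convert this using 2
      module

theorem f_mul_efPow_mem_span (d : ℤ) :
    f q * efPow q d ∈ Submodule.span ℂ (Set.range (monomial q s)) := by
  have hneg : ∀ n : ℕ, f q * efPow q (-n) ∈ Submodule.span ℂ (Set.range (monomial q s)) := by
    intro n
    rw [efPow_neg_natCast, ← pow_succ', ← efPow_neg_natCast]
    exact efPow_mem_span _
  obtain ⟨n, rfl | rfl⟩ := d.eq_nat_or_neg
  · cases n with
    | zero => simpa using hneg 0
    | succ n =>
      rw [efPow_natCast, pow_succ', ← mul_assoc, f_mul_e hs h0 h1, ← efPow_natCast]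
      exact mul_efPow_mem_span h0 _ _ _ _
  · exact hneg n

theorem span_monomial : ⊤ ≤ Submodule.span ℂ (Set.range (monomial q s)) := by
  have h : Subalgebra.toSubmodule (Algebra.adjoin ℂ (Set.range (mk q))) ≤
      Submodule.span ℂ (Set.range (monomial q s)) := by
    refine adjoin_le_of_mul_mem (by simpa [efPow] using efPow_mem_span (q := q) (s := s) 0) ?_
    rintro _ ⟨x, rfl⟩
    refine mul_mem_span ?_
    rintro _ ⟨m, rfl⟩
    cases x
    · change e q * _ ∈ _
      rw [monomial, ← mul_assoc, e_mul_kz_mul_scasimir_pow hs h0 h1, smul_mul_assoc,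
        mul_assoc _ (e q)]
      exact Submodule.smul_mem _ _ (kz_mul_scasimir_pow_mul_mem_span h0 _ _
        (e_mul_efPow_mem_span hs h0 h1 _))
    · change f q * _ ∈ _
      rw [monomial, ← mul_assoc, f_mul_kz_mul_scasimir_pow hs h0 h1, smul_mul_assoc,
        mul_assoc _ (f q)]
      exact Submodule.smul_mem _ _ (kz_mul_scasimir_pow_mul_mem_span h0 _ _
        (f_mul_efPow_mem_span hs h0 h1 _))
    · rw [mk_k, kz_mul_monomial]
      exact Submodule.subset_span ⟨_, rfl⟩
    · rw [mk_kinv, kz_mul_monomial]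
      exact Submodule.subset_span ⟨_, rfl⟩
  rwa [adjoin_gen, Algebra.top_toSubmodule] at h

end

/-- The basis of `U` consisting of the monomials in `k`, `S` and a power of `e` or `f`. -/
noncomputable def monomialBasis (hs : s ^ 2 = q) (h0 : q ≠ 0) (h1 : q ^ 2 ≠ 1) :
    Module.Basis (ℤ × ℤ × ℕ) ℂ (U q) :=
  Module.Basis.mk (linearIndependent_monomial hs h0 h1) (span_monomial hs h0 h1)

variable (hs : s ^ 2 = q) (h0 : q ≠ 0) (h1 : q ^ 2 ≠ 1)

theorem monomialBasis_apply (m : ℤ × ℤ × ℕ) :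
    monomialBasis hs h0 h1 m = monomial q s m := Module.Basis.mk_apply _ _ m

theorem coe_monomialBasis : ⇑(monomialBasis hs h0 h1) = monomial q s :=
  funext (monomialBasis_apply hs h0 h1)

/-- Evaluation at a single vector is already injective, since it sends the monomial basis to an
independent family. -/
theorem rep_injective : Function.Injective (rep hs h0 h1) := by
  have h : LinearMap.ker (LinearMap.applyₗ (Pi.single 0 1) ∘ₗ (rep hs h0 h1).toLinearMap) = ⊥ := by
    refine LinearMap.ker_eq_bot_of_injective ?_
    have := linearIndependent_rep_monomial hs h0 h1
    rw [← coe_monomialBasis hs h0 h1] at this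
    intro x y hxy
    refine (monomialBasis hs h0 h1).repr.injective (this ?_)
    rw [← (monomialBasis hs h0 h1).linearCombination_repr x,
      ← (monomialBasis hs h0 h1).linearCombination_repr y, Finsupp.apply_linearCombination,
      Finsupp.apply_linearCombination] at hxy
    exact hxy
  intro x y hxy
  refine LinearMap.ker_eq_bot.1 h ?_
  simp [hxy]

include hs h0 h1 in
-- In the faithful representation `e` acts as a shift, which is surjective.
theorem eq_zero_of_mul_e {u : U q} (hu : u * e q = 0) : u = 0 := by
  refine rep_injective hs h0 h1 ?_
  rw [map_zero]
  refine LinearMap.ext fun v => ?_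
  have hv : rep hs h0 h1 (e q) (fun i => v (i + 1)) = v := by
    ext1 i; rw [rep_e, sub_add_cancel]
  rw [← hv, ← Module.End.mul_apply, ← map_mul, hu, map_zero]
  rfl

end Spanning

/-! ### Operators diagonal in a basis -/

section Eigen

variable {ι M : Type*} [AddCommGroup M] [Module ℂ M] (b : Module.Basis ι ℂ M)

/-- The endomorphism that is diagonal in a given basis. -/
noncomputable def diagEnd (c : ι → ℂ) : M →ₗ[ℂ] M := b.constr ℂ fun i => c i • b i

theorem diagEnd_basis (c : ι → ℂ) (i : ι) : diagEnd b c (b i) = c i • b i := by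
  rw [diagEnd, Module.Basis.constr_basis]

theorem repr_diagEnd (c : ι → ℂ) (x : M) (i : ι) :
    b.repr (diagEnd b c x) i = c i * b.repr x i := by
  have h : b.coord i ∘ₗ diagEnd b c = c i • b.coord i := by
    refine b.ext fun j => ?_
    by_cases hij : j = i
    · subst hij; simp [diagEnd_basis]
    · simp [diagEnd_basis, hij]
  exact LinearMap.congr_fun h x

theorem eq_one_of_diagEnd_eq {c : ι → ℂ} {x : M} (h : diagEnd b c x = x) {i : ι}
    (hi : b.repr x i ≠ 0) : c i = 1 := by
  have h2 := repr_diagEnd b c x i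
  rw [h] at h2
  exact mul_right_cancel₀ hi (by rw [← h2, one_mul])

theorem injective_of_basis {N : Type*} [AddCommGroup N] [Module ℂ N] {T : M →ₗ[ℂ] N}
    (h : LinearIndependent ℂ (T ∘ b)) : Function.Injective T := by
  intro x y hxy
  refine b.repr.injective (h ?_)
  rw [← b.linearCombination_repr x, ← b.linearCombination_repr y,
    Finsupp.apply_linearCombination, Finsupp.apply_linearCombination] at hxy
  exact hxy

end Eigen

/-! ### The centre as a span of monomials -/

section Centre

variable {q s : ℂ}

theorem pow_mul_scasimir_of_anticomm {x : U q} (h : x * scasimir q s = -(scasimir q s * x))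
    (n : ℕ) : x ^ n * scasimir q s = (-1 : ℂ) ^ n • (scasimir q s * x ^ n) :=
  pow_mul_of_qcomm (by rw [h]; module) n

theorem e_pow_mul_kz (h0 : q ≠ 0) (m : ℕ) (n : ℤ) :
    e q ^ m * kz q n = ((q ^ n)⁻¹) ^ m • (kz q n * e q ^ m) :=
  pow_mul_of_qcomm (e_mul_kz h0 n) m

theorem f_pow_mul_kz (h0 : q ≠ 0) (m : ℕ) (n : ℤ) :
    f q ^ m * kz q n = (q ^ n) ^ m • (kz q n * f q ^ m) :=
  pow_mul_of_qcomm (f_mul_kz h0 n) m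

theorem efPow_mul_kz_one (h0 : q ≠ 0) (d : ℤ) :
    efPow q d * kz q 1 = (q ^ d)⁻¹ • (kz q 1 * efPow q d) := by
  obtain ⟨n, rfl | rfl⟩ := d.eq_nat_or_neg
  · rw [efPow_natCast, e_pow_mul_kz h0, zpow_one, inv_pow, zpow_natCast]
  · rw [efPow_neg_natCast, f_pow_mul_kz h0, zpow_one, zpow_neg, inv_inv, zpow_natCast]

section

variable (hs : s ^ 2 = q) (h0 : q ≠ 0) (h1 : q ^ 2 ≠ 1)
include hs h0 h1

theorem efPow_mul_scasimir (d : ℤ) :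
    efPow q d * scasimir q s = (-1 : ℂ) ^ d • (scasimir q s * efPow q d) := by
  obtain ⟨n, rfl | rfl⟩ := d.eq_nat_or_neg
  · rw [efPow_natCast, pow_mul_scasimir_of_anticomm (e_mul_scasimir hs h0 h1), zpow_natCast]
  · rw [efPow_neg_natCast, pow_mul_scasimir_of_anticomm (f_mul_scasimir hs h0 h1), zpow_neg,
      zpow_natCast, ← inv_pow, inv_neg_one]

/-- For `f`, one compares `(f e) e ^ (L-1)` with `e ^ (L-1) (e f)`. Moving `e ^ (L-1)` to the right
multiplies `k` by `q`, `k⁻¹` by `q⁻¹` and `S` by `-1`, which turns the formula for `e f` into the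
one for `f e`. -/
theorem e_pow_mem_centre {L : ℕ} (hL : q ^ L = 1) (hL2 : Even L) : e q ^ L ∈ centre q := by
  have hs0 : s ≠ 0 := by rintro rfl; exact h0 (by simpa using hs.symm)
  refine mem_centre_of_commute (by rw [← pow_succ, ← pow_succ']) ?_ ?_
  · cases L with
    | zero => simp
    | succ n =>
      have hq : q ^ n = q⁻¹ := by
        rw [pow_succ] at hL
        exact eq_inv_of_mul_eq_one_left hL
      have hn : (-1 : ℂ) ^ n = -1 := by
        have := hL2.neg_one_pow (α := ℂ)
        rw [pow_succ] at this
        linear_combination -this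
      rw [pow_succ', ← mul_assoc, f_mul_e hs h0 h1, ← pow_succ', pow_succ, mul_assoc,
        e_mul_f_eq hs h0 h1, mul_smul_comm, smul_mul_assoc]
      congr 1
      simp only [mul_add, mul_sub, sub_mul, mul_smul_comm, smul_mul_assoc, e_pow_mul_kz h0,
        pow_mul_scasimir_of_anticomm (e_mul_scasimir hs h0 h1), hn, zpow_one, zpow_neg, inv_inv,
        inv_pow, hq, smul_smul]
      subst hs
      match_scalars
      · field_simp
      · field_simp
      · ring
  · rw [e_pow_mul_kz h0, zpow_one, inv_pow, hL, inv_one, one_smul]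

theorem f_pow_mem_centre {L : ℕ} (hL : q ^ L = 1) (hL2 : Even L) : f q ^ L ∈ centre q := by
  have hs0 : s ≠ 0 := by rintro rfl; exact h0 (by simpa using hs.symm)
  refine mem_centre_of_commute ?_ (by rw [← pow_succ, ← pow_succ']) ?_
  · cases L with
    | zero => simp
    | succ n =>
      have hq : q ^ n = q⁻¹ := by
        rw [pow_succ] at hL
        exact eq_inv_of_mul_eq_one_left hL
      have hn : (-1 : ℂ) ^ n = -1 := by
        have := hL2.neg_one_pow (α := ℂ)
        rw [pow_succ] at this
        linear_combination -this
      rw [pow_succ', ← mul_assoc, e_mul_f_eq hs h0 h1, ← pow_succ', pow_succ, mul_assoc,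
        f_mul_e hs h0 h1, mul_smul_comm, smul_mul_assoc]
      congr 1
      simp only [mul_sub, add_mul, sub_mul, mul_smul_comm, smul_mul_assoc,
        f_pow_mul_kz h0, pow_mul_scasimir_of_anticomm (f_mul_scasimir hs h0 h1), hn, zpow_one,
        zpow_neg, inv_inv, inv_pow, hq, smul_smul]
      subst hs
      match_scalars
      · field_simp
      · field_simp
      · ring
  · rw [f_pow_mul_kz h0, zpow_one, hL, one_smul]

theorem efPow_mem_centre {L : ℕ} (hL : q ^ L = 1) (hL2 : Even L) {d : ℤ} (hd : (L : ℤ) ∣ d) :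
    efPow q d ∈ centre q := by
  obtain ⟨c, rfl⟩ := hd
  obtain ⟨n, rfl | rfl⟩ := c.eq_nat_or_neg
  · rw [← Nat.cast_mul, efPow_natCast, pow_mul]
    exact pow_mem (e_pow_mem_centre hs h0 h1 hL hL2) n
  · rw [mul_neg, ← Nat.cast_mul, efPow_neg_natCast, pow_mul]
    exact pow_mem (f_pow_mem_centre hs h0 h1 hL hL2) n

end

/-- The span of the monomials with index in a given set. -/
noncomputable def monoSpan (q s : ℂ) (T : Set (ℤ × ℤ × ℕ)) : Submodule ℂ (U q) :=
  Submodule.span ℂ (monomial q s '' T)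

/-- Indices of the monomials spanning the centre. -/
def centreIndex (q : ℂ) (L : ℕ) : Set (ℤ × ℤ × ℕ) :=
  {m | (L : ℤ) ∣ m.1 ∧ q ^ m.2.1 = (-1) ^ m.2.2}

theorem monomial_mem_monoSpan {T : Set (ℤ × ℤ × ℕ)} {m : ℤ × ℤ × ℕ} (hm : m ∈ T) :
    monomial q s m ∈ monoSpan q s T := Submodule.subset_span ⟨m, hm, rfl⟩

variable (hs : s ^ 2 = q) (h0 : q ≠ 0) (h1 : q ^ 2 ≠ 1)

theorem mem_monoSpan_iff {T : Set (ℤ × ℤ × ℕ)} {u : U q} :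
    u ∈ monoSpan q s T ↔ ∀ m, (monomialBasis hs h0 h1).repr u m ≠ 0 → m ∈ T := by
  rw [monoSpan, ← coe_monomialBasis hs h0 h1, Module.Basis.mem_span_image]
  simp [Set.subset_def]

include hs h0 h1

theorem monomial_mem_centre {L : ℕ} (hL : q ^ L = 1) (hL2 : Even L) {m : ℤ × ℤ × ℕ}
    (hm : m ∈ centreIndex q L) : monomial q s m ∈ centre q := by
  refine mul_mem ?_ (efPow_mem_centre hs h0 h1 hL hL2 hm.1)
  have hj : ((-1 : ℂ) ^ m.2.2) * (-1) ^ m.2.2 = 1 := by rw [← mul_pow]; simp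
  refine mem_centre_of_commute ?_ ?_ ?_
  · rw [e_mul_kz_mul_scasimir_pow hs h0 h1, hm.2, inv_mul_cancel₀ (by simp), one_smul]
  · rw [f_mul_kz_mul_scasimir_pow hs h0 h1, hm.2, hj, one_smul]
  · rw [mul_assoc, scasimir_pow_mul_kz h0, ← mul_assoc, ← mul_assoc, ← kz_add, ← kz_add,
      add_comm]

theorem scasimir_mul_injective : Function.Injective (LinearMap.mulLeft ℂ (scasimir q s)) := by
  refine injective_of_basis (monomialBasis hs h0 h1) ?_
  have h := (linearIndependent_monomial hs h0 h1).comp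
    (fun m : ℤ × ℤ × ℕ => (m.1, m.2.1, m.2.2 + 1)) (by
      rintro ⟨a, b, c⟩ ⟨a', b', c'⟩ h
      simpa using h)
  have h2 : LinearMap.mulLeft ℂ (scasimir q s) ∘ monomialBasis hs h0 h1 =
      monomial q s ∘ fun m : ℤ × ℤ × ℕ => (m.1, m.2.1, m.2.2 + 1) := by
    ext1 m
    simp [coe_monomialBasis, scasimir_mul_monomial h0]
  rw [h2]
  exact h

theorem mul_kz_one_eq (z : U q) : kz q 1 * z =
    diagEnd (monomialBasis hs h0 h1) (fun m => q ^ m.1) z * kz q 1 := by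
  have h : LinearMap.mulLeft ℂ (kz q 1) = LinearMap.mulRight ℂ (kz q 1) ∘ₗ
      diagEnd (monomialBasis hs h0 h1) (fun m => q ^ m.1) := by
    refine (monomialBasis hs h0 h1).ext fun m => ?_
    simp only [LinearMap.coe_comp, Function.comp_apply, diagEnd_basis, map_smul,
      LinearMap.mulLeft_apply, LinearMap.mulRight_apply]
    rw [monomialBasis_apply, kz_mul_monomial, monomial, monomial, mul_assoc _ _ (kz q 1),
      efPow_mul_kz_one h0, mul_smul_comm, smul_smul, mul_inv_cancel₀ (zpow_ne_zero _ h0),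
      one_smul, ← mul_assoc _ (kz q 1), mul_assoc _ _ (kz q 1), scasimir_pow_mul_kz h0,
      ← mul_assoc, ← kz_add, add_comm]
  exact LinearMap.congr_fun h z

theorem mul_scasimir_eq (z : U q) : z * scasimir q s =
    scasimir q s * diagEnd (monomialBasis hs h0 h1) (fun m => (-1) ^ m.1) z := by
  have h : LinearMap.mulRight ℂ (scasimir q s) = LinearMap.mulLeft ℂ (scasimir q s) ∘ₗ
      diagEnd (monomialBasis hs h0 h1) (fun m => (-1) ^ m.1) := by
    refine (monomialBasis hs h0 h1).ext fun m => ?_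
    simp only [LinearMap.coe_comp, Function.comp_apply, diagEnd_basis, map_smul,
      LinearMap.mulLeft_apply, LinearMap.mulRight_apply]
    rw [monomialBasis_apply, scasimir_mul_monomial h0, monomial, monomial, mul_assoc,
      efPow_mul_scasimir hs h0 h1, mul_smul_comm, ← mul_assoc, pow_succ, ← mul_assoc]
  exact LinearMap.congr_fun h z

/-- The restriction to `L ∣ d` makes `efPow q d` central, so that `e` can be carried all the way to
the right. -/
theorem e_mul_eq {L : ℕ} (hL : q ^ L = 1) (hL2 : Even L) {z : U q}
    (hz : z ∈ monoSpan q s {m | (L : ℤ) ∣ m.1}) : e q * z =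
    diagEnd (monomialBasis hs h0 h1) (fun m => (q ^ m.2.1)⁻¹ * (-1) ^ m.2.2) z * e q := by
  have h : Set.EqOn (LinearMap.mulLeft ℂ (e q)) (LinearMap.mulRight ℂ (e q) ∘ₗ
      diagEnd (monomialBasis hs h0 h1) (fun m => (q ^ m.2.1)⁻¹ * (-1) ^ m.2.2))
      (monomial q s '' {m | (L : ℤ) ∣ m.1}) := by
    rintro _ ⟨m, hm, rfl⟩
    rw [← monomialBasis_apply hs h0 h1]
    simp only [LinearMap.coe_comp, Function.comp_apply, diagEnd_basis, map_smul,
      LinearMap.mulLeft_apply, LinearMap.mulRight_apply]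
    rw [monomialBasis_apply]
    have hc := (Subalgebra.mem_center_iff (R := ℂ)).1 (efPow_mem_centre hs h0 h1 hL hL2 hm) (e q)
    rw [monomial, ← mul_assoc, e_mul_kz_mul_scasimir_pow hs h0 h1, smul_mul_assoc, mul_assoc,
      hc, ← mul_assoc (kz q _ * _)]
  exact LinearMap.eqOn_span h hz

theorem centre_eq {L : ℕ} (hL : q ^ L = 1) (hL2 : Even L)
    (hL3 : ∀ d : ℤ, q ^ d = 1 → Even d → (L : ℤ) ∣ d) :
    Subalgebra.toSubmodule (centre q) = monoSpan q s (centreIndex q L) := by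
  refine le_antisymm (fun z hz => ?_) (Submodule.span_le.2 ?_)
  · have hz' : ∀ b : U q, b * z = z * b := (Subalgebra.mem_center_iff (R := ℂ)).1 hz
    have hk : diagEnd (monomialBasis hs h0 h1) (fun m => q ^ m.1) z = z := by
      have := mul_kz_one_eq hs h0 h1 z
      rw [hz'] at this
      exact ((k q ^ (1 : ℤ)).isUnit.mul_right_cancel this).symm
    -- Commutation with `S` detects the parity of `d`, which `q ^ d = 1` alone does not when `l` is
    -- odd.
    have hS : diagEnd (monomialBasis hs h0 h1) (fun m => (-1) ^ m.1) z = z := by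
      have := mul_scasimir_eq hs h0 h1 z
      rw [← hz'] at this
      exact (scasimir_mul_injective hs h0 h1 this).symm
    have hd : ∀ m, (monomialBasis hs h0 h1).repr z m ≠ 0 → (L : ℤ) ∣ m.1 := fun m hm => by
      refine hL3 _ (eq_one_of_diagEnd_eq _ hk hm) ?_
      have := eq_one_of_diagEnd_eq _ hS hm
      by_contra hodd
      rw [Int.not_even_iff_odd] at hodd
      rw [hodd.neg_one_zpow] at this
      norm_num at this
    have he : diagEnd (monomialBasis hs h0 h1) (fun m => (q ^ m.2.1)⁻¹ * (-1) ^ m.2.2) z = z := by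
      have := e_mul_eq hs h0 h1 hL hL2 ((mem_monoSpan_iff hs h0 h1).2 hd)
      rw [hz', ← sub_eq_zero, ← sub_mul] at this
      exact (sub_eq_zero.1 (eq_zero_of_mul_e hs h0 h1 this)).symm
    refine (mem_monoSpan_iff hs h0 h1).2 fun m hm => ⟨hd m hm, ?_⟩
    have := eq_one_of_diagEnd_eq _ he hm
    rw [inv_mul_eq_one₀ (zpow_ne_zero _ h0)] at this
    exact this
  · rintro _ ⟨m, hm, rfl⟩
    exact monomial_mem_centre hs h0 h1 hL hL2 hm

end Centre

/-! ### Independence under translation of a variable -/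

section LinearIndependence

theorem linearIndependent_of_forall_eq {ι M : Type*} [AddCommGroup M] [Module ℂ M] {v w : ι → M}
    (h : LinearIndependent ℂ v) (hvw : ∀ i, w i = v i) : LinearIndependent ℂ w :=
  (funext hvw : w = v) ▸ h

/-- The hypothesis says that `(p_a) ↦ ∑ p_a(y) w_a` is injective on families of polynomials, and the
powers of `X + t` are independent since Taylor shift is injective. With `y = S²` and `t = 2` this
passes from `S²` to `C`. -/
theorem linearIndependent_add_algebraMap_pow_mul {A α : Type*} [Ring A] [Algebra ℂ A] {y : A}
    {w : α → A} (t : ℂ) (h : LinearIndependent ℂ fun p : α × ℕ => y ^ p.2 * w p.1) :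
    LinearIndependent ℂ fun p : α × ℕ => (y + algebraMap ℂ A t) ^ p.2 * w p.1 := by
  let Θ : (α →₀ Polynomial ℂ) →ₗ[ℂ] A := Finsupp.lsum ℂ fun a =>
    LinearMap.mulRight ℂ (w a) ∘ₗ (Polynomial.aeval y).toLinearMap
  have hΘ (a : α) (p : Polynomial ℂ) :
      Θ (Finsupp.single a p) = Polynomial.aeval y p * w a := by simp [Θ]
  have hinj : Function.Injective Θ := by
    refine injective_of_basis (Finsupp.basis fun _ => Polynomial.basisMonomials ℂ) ?_
    have h2 := (linearIndependent_equiv (Equiv.sigmaEquivProd α ℕ)).2 h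
    refine linearIndependent_of_forall_eq h2 fun p => ?_
    simp [hΘ, Finsupp.coe_basis, Polynomial.aeval_monomial]
  have hX : LinearIndependent ℂ (fun n : ℕ => (Polynomial.X + Polynomial.C t) ^ n) := by
    have h3 := (Polynomial.basisMonomials ℂ).linearIndependent.map' (Polynomial.taylor t)
      (LinearMap.ker_eq_bot_of_injective (Polynomial.taylor_injective t))
    refine linearIndependent_of_forall_eq h3 fun n => ?_
    simp [Polynomial.taylor_monomial]
  have h4 := (Finsupp.linearIndependent_single (ι := α) _ (fun _ => hX)).map' Θ
    (LinearMap.ker_eq_bot_of_injective hinj)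
  refine (linearIndependent_equiv (Equiv.sigmaEquivProd α ℕ)).1 ?_
  refine linearIndependent_of_forall_eq h4 fun p => ?_
  simp [hΘ]

end LinearIndependence

/-! ### Monomial spans of the subalgebras -/

section Subalgebras

variable {q s : ℂ}

theorem kz_mul_natCast (m : ℤ) (n : ℕ) : kz q (m * n) = kz q m ^ n := by
  rw [kz, zpow_mul, zpow_natCast, Units.val_pow_eq_pow_val]

/-- Indices of the monomials in `k ^ (± l)`, `S ^ 2` and the powers of `e`, `f` given by `D`. -/
def levelIndex (l : ℕ) (D : Set ℤ) : Set (ℤ × ℤ × ℕ) :=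
  {m | m.1 ∈ D ∧ (l : ℤ) ∣ m.2.1 ∧ Even m.2.2}

theorem mul_mem_monoSpan {T : Set (ℤ × ℤ × ℕ)} {g : U q}
    (h : ∀ m ∈ T, g * monomial q s m ∈ monoSpan q s T) :
    ∀ u ∈ monoSpan q s T, g * u ∈ monoSpan q s T := by
  refine mul_mem_span ?_
  rintro _ ⟨m, hm, rfl⟩
  exact h m hm

/-- One argument for all three subalgebras: `G` is empty, `{F}` or `{E}`, and `D` is the set of
degrees reached. The span is stable under left multiplication by the generators, and conversely `S²
= C - 2` places each monomial in the subalgebra. -/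
theorem adjoin_union_eq_monoSpan (hs : s ^ 2 = q) (h0 : q ≠ 0) (h1 : q ^ 2 ≠ 1) (l : ℕ)
    {G : Set (U q)} {D : Set ℤ} (hD0 : 0 ∈ D) (hG : ∀ g ∈ G, g ∈ centre q)
    (hGD : ∀ g ∈ G, ∀ d ∈ D, ∃ d' ∈ D, g * efPow q d = efPow q d')
    (hD : ∀ d ∈ D, efPow q d ∈
      Algebra.adjoin ℂ ({kz q l, kz q (-l), casimir q} ∪ G : Set (U q))) :
    Subalgebra.toSubmodule
      (Algebra.adjoin ℂ ({kz q l, kz q (-l), casimir q} ∪ G : Set (U q))) =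
        monoSpan q s (levelIndex l D) := by
  refine le_antisymm (adjoin_le_of_mul_mem ?_ ?_) (Submodule.span_le.2 ?_)
  · have : monomial q s (0, 0, 0) = 1 := by simp [monomial, efPow]
    rw [← this]
    exact monomial_mem_monoSpan ⟨hD0, dvd_zero _, Even.zero⟩
  · intro g hg
    refine mul_mem_monoSpan fun m hm => ?_
    rcases hg with (rfl | rfl | rfl) | hg
    · rw [kz_mul_monomial]
      exact monomial_mem_monoSpan ⟨hm.1, dvd_add dvd_rfl hm.2.1, hm.2.2⟩
    · rw [kz_mul_monomial]
      exact monomial_mem_monoSpan ⟨hm.1, dvd_add (dvd_neg.2 dvd_rfl) hm.2.1, hm.2.2⟩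
    · rw [casimir_mul_monomial hs h0 h1]
      exact add_mem (monomial_mem_monoSpan ⟨hm.1, hm.2.1, hm.2.2.add even_two⟩)
        (Submodule.smul_mem _ _ (monomial_mem_monoSpan hm))
    · obtain ⟨d', hd', h⟩ := hGD g hg m.1 hm.1
      rw [monomial, ← mul_assoc, ← (Subalgebra.mem_center_iff (R := ℂ)).1 (hG g hg), mul_assoc,
        h]
      exact monomial_mem_monoSpan (m := (d', m.2)) ⟨hd', hm.2⟩
  · rintro _ ⟨⟨d, n, j⟩, ⟨hd, ⟨a, rfl⟩, ⟨i, rfl⟩⟩, rfl⟩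
    set B := Algebra.adjoin ℂ ({kz q l, kz q (-l), casimir q} ∪ G : Set (U q)) with hB
    have hgen : ∀ x ∈ ({kz q l, kz q (-l), casimir q} ∪ G : Set (U q)), x ∈ B :=
      fun x hx => Algebra.subset_adjoin hx
    change kz q (l * a) * scasimir q s ^ (i + i) * efPow q d ∈ B
    refine mul_mem (mul_mem ?_ ?_) (hD d hd)
    · obtain ⟨n, rfl | rfl⟩ := a.eq_nat_or_neg
      · rw [kz_mul_natCast]
        exact pow_mem (hgen _ (by simp)) n
      · rw [mul_neg, ← neg_mul, kz_mul_natCast]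
        exact pow_mem (hgen _ (by simp)) n
    · have hS : scasimir q s ^ 2 = casimir q - algebraMap ℂ (U q) 2 := by
        rw [casimir_eq hs h0 h1, add_sub_cancel_right]
      rw [← two_mul, pow_mul, hS]
      exact pow_mem (sub_mem (hgen _ (by simp)) (algebraMap_mem _ _)) i

end Subalgebras

/-! ### The sum, the intersection, odd `l`, and polynomial independence -/

section Main

theorem dvd_evenMult (l : ℕ) : l ∣ evenMult l := by
  unfold evenMult
  split_ifs
  · exact dvd_rfl
  · exact dvd_mul_left _ _

theorem even_evenMult (l : ℕ) : Even (evenMult l) := by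
  unfold evenMult
  split_ifs with h
  · exact h
  · exact even_two_mul l

theorem evenMult_dvd {l : ℕ} {d : ℤ} (h : (l : ℤ) ∣ d) (hd : Even d) : (evenMult l : ℤ) ∣ d := by
  unfold evenMult
  split_ifs with hl
  · exact h
  · rw [Nat.cast_mul]
    refine IsCoprime.mul_dvd ?_ hd.two_dvd h
    rw [Nat.isCoprime_iff_coprime, Nat.coprime_two_left]
    exact Nat.not_even_iff_odd.1 hl

variable {l : ℕ} {q s : ℂ}

theorem pow_evenMult (hq : IsPrimitiveRoot q l) : q ^ evenMult l = 1 :=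
  (hq.pow_eq_one_iff_dvd _).2 (dvd_evenMult l)

theorem algC_eq_adjoin :
    algC q l = Algebra.adjoin ℂ ({kz q l, kz q (-l), casimir q} ∪ ∅ : Set (U q)) := by
  rw [Set.union_empty]; rfl

theorem algF_eq_adjoin :
    algF q l = Algebra.adjoin ℂ ({kz q l, kz q (-l), casimir q} ∪ {F q l} : Set (U q)) := by
  rw [Set.insert_union, Set.insert_union, Set.singleton_union]; rfl

theorem algE_eq_adjoin :
    algE q l = Algebra.adjoin ℂ ({kz q l, kz q (-l), casimir q} ∪ {E q l} : Set (U q)) := by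
  rw [Set.insert_union, Set.insert_union, Set.singleton_union]; rfl

theorem algC_le_algF : algC q l ≤ algF q l := by
  rw [algC_eq_adjoin, algF_eq_adjoin]
  exact Algebra.adjoin_mono (Set.union_subset_union_right _ (Set.empty_subset _))

theorem algC_le_algE : algC q l ≤ algE q l := by
  rw [algC_eq_adjoin, algE_eq_adjoin]
  exact Algebra.adjoin_mono (Set.union_subset_union_right _ (Set.empty_subset _))

theorem F_mem_algF : F q l ∈ algF q l := Algebra.subset_adjoin (by simp)

theorem E_mem_algE : E q l ∈ algE q l := Algebra.subset_adjoin (by simp)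

theorem efPow_evenMult_mul (c : ℕ) : efPow q (evenMult l * c) = E q l ^ c := by
  rw [← Nat.cast_mul, efPow_natCast, pow_mul, E]

theorem efPow_neg_evenMult_mul (c : ℕ) : efPow q (-(evenMult l * c)) = F q l ^ c := by
  rw [← Nat.cast_mul, efPow_neg_natCast, pow_mul, F]

variable (hs : s ^ 2 = q) (h0 : q ≠ 0) (h1 : q ^ 2 ≠ 1)
include hs h0 h1

theorem algC_eq_monoSpan :
    Subalgebra.toSubmodule (algC q l) = monoSpan q s (levelIndex l {0}) := by
  rw [algC_eq_adjoin]
  refine adjoin_union_eq_monoSpan hs h0 h1 l rfl (by simp) (by simp) ?_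
  rintro _ rfl
  simp [efPow]

theorem algF_eq_monoSpan (hq : IsPrimitiveRoot q l) : Subalgebra.toSubmodule (algF q l) =
    monoSpan q s (levelIndex l (Set.range fun c : ℕ => -(evenMult l * c : ℤ))) := by
  rw [algF_eq_adjoin]
  refine adjoin_union_eq_monoSpan hs h0 h1 l ⟨0, by simp⟩ ?_ ?_ ?_
  · rintro _ rfl
    exact f_pow_mem_centre hs h0 h1 (pow_evenMult hq) (even_evenMult l)
  · rintro _ rfl _ ⟨c, rfl⟩
    refine ⟨_, ⟨c + 1, rfl⟩, ?_⟩
    simp only [efPow_neg_evenMult_mul, pow_succ']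
  · rintro _ ⟨c, rfl⟩
    simp only [efPow_neg_evenMult_mul, ← algF_eq_adjoin]
    exact pow_mem F_mem_algF c

theorem algE_eq_monoSpan (hq : IsPrimitiveRoot q l) : Subalgebra.toSubmodule (algE q l) =
    monoSpan q s (levelIndex l (Set.range fun c : ℕ => (evenMult l * c : ℤ))) := by
  rw [algE_eq_adjoin]
  refine adjoin_union_eq_monoSpan hs h0 h1 l ⟨0, by simp⟩ ?_ ?_ ?_
  · rintro _ rfl
    exact e_pow_mem_centre hs h0 h1 (pow_evenMult hq) (even_evenMult l)
  · rintro _ rfl _ ⟨c, rfl⟩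
    refine ⟨_, ⟨c + 1, rfl⟩, ?_⟩
    simp only [efPow_evenMult_mul, pow_succ']
  · rintro _ ⟨c, rfl⟩
    simp only [efPow_evenMult_mul, ← algE_eq_adjoin]
    exact pow_mem E_mem_algE c

/-- The algebra with `F` supplies the degrees that are nonpositive multiples of `L`, the one with
`E` the nonnegative ones. -/
theorem sumFE_eq_monoSpan (hq : IsPrimitiveRoot q l) :
    sumFE q l = monoSpan q s (levelIndex l {d | (evenMult l : ℤ) ∣ d}) := by
  rw [sumFE, algF_eq_monoSpan hs h0 h1 hq, algE_eq_monoSpan hs h0 h1 hq, monoSpan, monoSpan,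
    ← Submodule.span_union, ← Set.image_union, monoSpan]
  congr 2
  ext ⟨d, n, j⟩
  simp only [levelIndex, Set.mem_union, Set.mem_ofPred_eq, ← or_and_right]
  refine and_congr_left fun _ => ⟨?_, ?_⟩
  · rintro (⟨c, rfl⟩ | ⟨c, rfl⟩)
    · exact dvd_neg.2 (dvd_mul_right _ _)
    · exact dvd_mul_right _ _
  · rintro ⟨c, rfl⟩
    obtain ⟨n, rfl | rfl⟩ := c.eq_nat_or_neg
    · exact Or.inr ⟨n, rfl⟩
    · exact Or.inl ⟨n, by simp⟩

theorem centre_eq_monoSpan (hq : IsPrimitiveRoot q l) :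
    Subalgebra.toSubmodule (centre q) = monoSpan q s (centreIndex q (evenMult l)) :=
  centre_eq hs h0 h1 (pow_evenMult hq) (even_evenMult l) fun d hd hd2 =>
    evenMult_dvd ((hq.zpow_eq_one_iff_dvd d).1 hd) hd2

theorem sumFE_le_centre (hq : IsPrimitiveRoot q l) :
    sumFE q l ≤ Subalgebra.toSubmodule (centre q) := by
  rw [sumFE_eq_monoSpan hs h0 h1 hq, centre_eq_monoSpan hs h0 h1 hq]
  refine Submodule.span_mono (Set.image_mono fun m hm => ⟨hm.1, ?_⟩)
  rw [(hq.zpow_eq_one_iff_dvd _).2 hm.2.1, hm.2.2.neg_one_pow]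

theorem algF_inf_algE (hl : l ≠ 0) (hq : IsPrimitiveRoot q l) :
    algF q l ⊓ algE q l = algC q l := by
  refine le_antisymm ?_ (le_inf algC_le_algF algC_le_algE)
  rintro u ⟨hF, hE⟩
  have hL : (0 : ℤ) < evenMult l := by
    have : evenMult l ≠ 0 := by unfold evenMult; split_ifs <;> omega
    omega
  change u ∈ Subalgebra.toSubmodule (algF q l) at hF
  change u ∈ Subalgebra.toSubmodule (algE q l) at hE
  change u ∈ Subalgebra.toSubmodule (algC q l)
  rw [algF_eq_monoSpan hs h0 h1 hq, mem_monoSpan_iff hs h0 h1] at hF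
  rw [algE_eq_monoSpan hs h0 h1 hq, mem_monoSpan_iff hs h0 h1] at hE
  rw [algC_eq_monoSpan hs h0 h1, mem_monoSpan_iff hs h0 h1]
  intro m hm
  obtain ⟨⟨c, hc⟩, h⟩ := hF m hm
  obtain ⟨⟨c', hc'⟩, -⟩ := hE m hm
  refine ⟨?_, h⟩
  -- The degree is both nonpositive and nonnegative, hence zero.
  have h2 : (0 : ℤ) ≤ evenMult l * c := by positivity
  have h3 : (0 : ℤ) ≤ evenMult l * c' := by positivity
  simp only at hc hc'
  exact Set.mem_singleton_iff.2 (by omega)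

theorem sumFE_eq_centre_of_odd (hl : Odd l) (hq : IsPrimitiveRoot q l) :
    sumFE q l = Subalgebra.toSubmodule (centre q) := by
  refine le_antisymm (sumFE_le_centre hs h0 h1 hq) ?_
  rw [sumFE_eq_monoSpan hs h0 h1 hq, centre_eq_monoSpan hs h0 h1 hq]
  refine Submodule.span_mono (Set.image_mono fun m hm => ⟨hm.1, ?_⟩)
  have h : (-1 : ℂ) ^ m.2.2 = 1 := by
    -- Raise `q ^ n = (-1) ^ j` to the power `l`; as `l` is odd, the sign survives.
    have h2 : ((-1 : ℂ) ^ m.2.2) ^ l = 1 := by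
      rw [← hm.2, ← zpow_natCast, ← zpow_mul, mul_comm, zpow_mul, zpow_natCast, hq.pow_eq_one,
        one_zpow]
    rwa [← pow_mul, mul_comm, pow_mul, hl.neg_one_pow] at h2
  refine ⟨(hq.zpow_eq_one_iff_dvd _).1 (hm.2.trans h), ?_⟩
  by_contra hodd
  rw [(Nat.not_even_iff_odd.1 hodd).neg_one_pow] at h
  norm_num at h

theorem linearIndependent_kz_casimir_efPow (hl : l ≠ 0) {g : U q} {D : ℕ → ℤ}
    (hD : Function.Injective D) (hg : ∀ c, efPow q (D c) = g ^ c) :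
    LinearIndependent ℂ (fun m : ℤ × ℕ × ℕ =>
      kz q (l * m.1) * casimir q ^ m.2.1 * g ^ m.2.2) := by
  -- With `S²` in place of `C` the family is part of the monomial basis.
  have h := linearIndependent_add_algebraMap_pow_mul (2 : ℂ)
    (y := scasimir q s ^ 2) (w := fun p : ℤ × ℕ => kz q (l * p.1) * g ^ p.2) (by
      have h2 := (linearIndependent_monomial hs h0 h1).comp
        (fun p : (ℤ × ℕ) × ℕ => (D p.1.2, (l : ℤ) * p.1.1, 2 * p.2)) (by
          rintro ⟨⟨a, c⟩, b⟩ ⟨⟨a', c'⟩, b'⟩ h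
          simpa [hl, hD.eq_iff, and_comm, and_left_comm, and_assoc] using h)
      refine linearIndependent_of_forall_eq h2 fun p => ?_
      simp only [Function.comp_apply, monomial, hg, ← mul_assoc, ← pow_mul,
        scasimir_pow_mul_kz h0])
  have h2 := h.comp (fun m : ℤ × ℕ × ℕ => ((m.1, m.2.2), m.2.1)) (by
    rintro ⟨a, b, c⟩ ⟨a', b', c'⟩ h
    simpa [and_comm, and_left_comm, and_assoc] using h)
  refine linearIndependent_of_forall_eq h2 fun m => ?_
  have hc : Commute (kz q (l * m.1)) (casimir q) := by
    rw [casimir_eq hs h0 h1]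
    exact (Commute.pow_right (kz_mul_scasimir h0 _) 2).add_right
      (Algebra.commutes _ _).symm
  simp only [Function.comp_apply, ← casimir_eq hs h0 h1, ← mul_assoc,
    (hc.pow_right m.2.1).eq]

end Main

/-! ### Even `l`: freeness over the sum, and the product `E F` -/

section Even

variable {l : ℕ} {q s : ℂ}

theorem evenMult_of_even (hl : Even l) : evenMult l = l := if_pos hl

theorem pow_half_eq_neg_one (hl0 : l ≠ 0) (hl : Even l) (hq : IsPrimitiveRoot q l) :
    q ^ (l / 2) = -1 := by
  obtain ⟨r, rfl⟩ := hl
  have hr : (r + r) / 2 = r := by omega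
  rw [hr]
  have h : (q ^ r) ^ 2 = 1 := by rw [← pow_mul, mul_two, hq.pow_eq_one]
  exact (sq_eq_one_iff.1 h).resolve_left (hq.pow_ne_one_of_pos_of_lt (by omega) (by omega))

theorem kS_eq : kS q s l = kz q (l / 2 : ℕ) * scasimir q s := by
  rw [kS, kz, zpow_natCast]

theorem kS_mul_monomial (h0 : q ≠ 0) (m : ℤ × ℤ × ℕ) :
    kS q s l * monomial q s m = monomial q s (m.1, (l / 2 : ℕ) + m.2.1, m.2.2 + 1) := by
  rw [kS_eq, mul_assoc, scasimir_mul_monomial h0, kz_mul_monomial]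

theorem mem_sumFE_of_mem_algF {x : U q} (hx : x ∈ algF q l) : x ∈ sumFE q l :=
  Submodule.mem_sup_left hx

theorem mem_sumFE_of_mem_algE {x : U q} (hx : x ∈ algE q l) : x ∈ sumFE q l :=
  Submodule.mem_sup_right hx

variable (hs : s ^ 2 = q) (h0 : q ≠ 0) (h1 : q ^ 2 ≠ 1)
include hs h0 h1

theorem kS_mem_centre (hl0 : l ≠ 0) (hl : Even l) (hq : IsPrimitiveRoot q l) :
    kS q s l ∈ centre q := by
  have h : monomial q s (0, (l / 2 : ℕ), 1) = kS q s l := by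
    simp [monomial, efPow, kS_eq]
  rw [← h]
  refine monomial_mem_centre hs h0 h1 (pow_evenMult hq) (even_evenMult l) ⟨dvd_zero _, ?_⟩
  change q ^ ((l / 2 : ℕ) : ℤ) = (-1) ^ 1
  rw [zpow_natCast, pow_one, pow_half_eq_neg_one hl0 hl hq]

/-- A central monomial with `j` even lies in the sum. If `j` is odd then `q ^ n = -1 = q ^ (l/2)`,
so dividing out `k^{l/2} S` leaves a monomial of the sum. -/
theorem exists_eq_add_mul_kS (hl0 : l ≠ 0) (hl : Even l) (hq : IsPrimitiveRoot q l) {z : U q}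
    (hz : z ∈ centre q) : ∃ u ∈ sumFE q l, ∃ v ∈ sumFE q l, z = u + v * kS q s l := by
  have hle : Subalgebra.toSubmodule (centre q) ≤
      sumFE q l ⊔ (sumFE q l).map (LinearMap.mulRight ℂ (kS q s l)) := by
    rw [centre_eq_monoSpan hs h0 h1 hq, sumFE_eq_monoSpan hs h0 h1 hq]
    refine Submodule.span_le.2 ?_
    rintro _ ⟨⟨d, n, j⟩, ⟨hd, hnj⟩, rfl⟩
    simp only at hd hnj
    obtain hj | ⟨i, rfl⟩ := j.even_or_odd
    · refine Submodule.mem_sup_left (monomial_mem_monoSpan ⟨hd, ?_, hj⟩)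
      rw [hj.neg_one_pow] at hnj
      exact (hq.zpow_eq_one_iff_dvd _).1 hnj
    · refine Submodule.mem_sup_right ⟨monomial q s (d, n - (l / 2 : ℕ), 2 * i),
        monomial_mem_monoSpan ⟨hd, ?_, even_two_mul i⟩, ?_⟩
      · rw [(odd_two_mul_add_one i).neg_one_pow] at hnj
        refine (hq.zpow_eq_one_iff_dvd _).1 ?_
        rw [zpow_sub₀ h0, zpow_natCast, pow_half_eq_neg_one hl0 hl hq, hnj]
        norm_num
      · rw [LinearMap.mulRight_apply,
          (Subalgebra.mem_center_iff (R := ℂ)).1 (kS_mem_centre hs h0 h1 hl0 hl hq),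
          kS_mul_monomial h0, add_sub_cancel]
  obtain ⟨u, hu, _, ⟨v, hv, rfl⟩, h⟩ := Submodule.mem_sup.1 (hle hz)
  exact ⟨u, hu, v, hv, h.symm⟩

/-- Parity of the exponent of `S` separates the two summands; then `k^{l/2}`, a unit, and `S`, left
cancellable, are removed. -/
theorem eq_zero_of_add_mul_kS_eq_zero (hl0 : l ≠ 0) (hl : Even l) (hq : IsPrimitiveRoot q l)
    {u v : U q} (hu : u ∈ sumFE q l) (hv : v ∈ sumFE q l) (h : u + v * kS q s l = 0) :
    u = 0 ∧ v = 0 := by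
  rw [(Subalgebra.mem_center_iff (R := ℂ)).1 (kS_mem_centre hs h0 h1 hl0 hl hq)] at h
  rw [sumFE_eq_monoSpan hs h0 h1 hq] at hu hv
  have hodd : kS q s l * v ∈ monoSpan q s {m | Odd m.2.2} := by
    refine mul_mem_span ?_ v hv
    rintro _ ⟨m, hm, rfl⟩
    rw [kS_mul_monomial h0]
    exact monomial_mem_monoSpan hm.2.2.add_one
  have hu0 : u = 0 := by
    refine (monomialBasis hs h0 h1).repr.injective (Finsupp.ext fun m => ?_)
    rw [map_zero, Finsupp.zero_apply]
    by_contra hm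
    rw [eq_neg_of_add_eq_zero_right h] at hodd
    have h2 := (mem_monoSpan_iff hs h0 h1).1 hodd m (by simpa using hm)
    exact Nat.not_even_iff_odd.2 h2 ((mem_monoSpan_iff hs h0 h1).1 hu m hm).2.2
  refine ⟨hu0, ?_⟩
  rw [hu0, zero_add, kS_eq, mul_assoc] at h
  have h2 : scasimir q s * v = 0 := by
    refine (k q ^ ((l / 2 : ℕ) : ℤ)).isUnit.mul_left_cancel ?_
    rw [mul_zero]; exact h
  exact scasimir_mul_injective hs h0 h1 (by simpa using h2)

/-- The homomorphism from the commutative Laurent polynomials onto `ℂ[k, k⁻¹, S]`. -/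
noncomputable def coefHom (q s : ℂ) (h0 : q ≠ 0) : Coef →ₐ[ℂ] U q :=
  AddMonoidAlgebra.lift ℂ (U q) (ℤ × ℕ)
    { toFun := fun p => kz q p.toAdd.1 * scasimir q s ^ p.toAdd.2
      map_one' := by simp
      map_mul' := fun x y => by
        simp only [toAdd_mul, Prod.fst_add, Prod.snd_add, kz_add, pow_add]
        rw [mul_assoc, mul_assoc, ← mul_assoc (kz q y.toAdd.1), ← scasimir_pow_mul_kz h0]
        simp only [mul_assoc] }

omit hs h1 in
theorem coefHom_mono (n : ℤ) (j : ℕ) :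
    coefHom q s h0 (mono n j) = kz q n * scasimir q s ^ j := by
  rw [coefHom, mono, AddMonoidAlgebra.lift_single, one_smul]; rfl

/-- `e ^ n f ^ n` is a product of `n` of these elements. -/
noncomputable def efWeight (q s : ℂ) (n : ℕ) : Coef :=
  (eta q s)⁻¹ • ((s * q ^ n)⁻¹ • mono 1 0 - (s * q ^ n) • mono (-1) 0 + (-1 : ℂ) ^ n • mono 0 1)

/-- Inductively, the inner `e f` of `e ^ n (e f) f ^ n` is pulled to the left through `e ^ n`, which
scales `k` by `q ^ (-n)` and `S` by `(-1) ^ n`. -/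
theorem e_pow_mul_f_pow (n : ℕ) :
    e q ^ n * f q ^ n = coefHom q s h0 (∏ i ∈ Finset.range n, efWeight q s i) := by
  induction n with
  | zero => simp
  | succ n ih =>
    rw [Finset.prod_range_succ, mul_comm, map_mul, ← ih, pow_succ, pow_succ' (f q), mul_assoc,
      ← mul_assoc (e q) (f q), e_mul_f_eq hs h0 h1, ← mul_assoc, ← mul_assoc]
    congr 1
    simp only [efWeight, map_smul, map_add, map_sub, coefHom_mono, mul_smul_comm, mul_add,
      mul_sub, e_pow_mul_kz h0, pow_mul_scasimir_of_anticomm (e_mul_scasimir hs h0 h1),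
      smul_mul_assoc, add_mul, sub_mul, pow_zero, pow_one, mul_one, one_mul, kz_zero, smul_smul,
      zpow_one, zpow_neg, inv_inv, mul_inv, inv_pow]

omit hs h0 h1 in
-- Passing from `n` to `h + n` negates the part in `t` and, as `h` is even, keeps the part in `x`:
-- the product has the form `(a + b)(-a + b) = b² - a²`. Evenness of `h = l/2` is where `4 ∣ l`
-- enters.
theorem efWeight_mul {h n : ℕ} (hh : Even h) (hqh : q ^ h = -1) :
    efWeight q s n * efWeight q s (h + n) =
      ((eta q s)⁻¹ ^ 2) •
        (mono 0 2 - ((s * q ^ n)⁻¹ • mono 1 0 - (s * q ^ n) • mono (-1) 0) ^ 2) := by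
  have h1 : efWeight q s (h + n) = (eta q s)⁻¹ • (-((s * q ^ n)⁻¹ • mono 1 0 -
      (s * q ^ n) • mono (-1) 0) + (-1 : ℂ) ^ n • mono 0 1) := by
    rw [efWeight, pow_add, pow_add, hqh, hh.neg_one_pow, neg_one_mul, mul_neg, one_mul, inv_neg]
    module
  have h2 : ((-1 : ℂ) ^ n • mono 0 1) ^ 2 = mono 0 2 := by
    rw [smul_pow, ← pow_mul, mul_comm n, pow_mul, neg_one_sq, one_pow, one_smul, pow_two,
      mono_mul_mono]
    rfl
  rw [h1, efWeight, smul_mul_smul_comm, ← pow_two, ← h2]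
  congr 1
  ring

theorem E_mul_F_mem_algC (hl0 : l ≠ 0) (hl : 4 ∣ l) (hq : IsPrimitiveRoot q l) :
    E q l * F q l ∈ algC q l := by
  have hle : Even l := (even_iff_two_dvd.2 ((by norm_num : 2 ∣ 4).trans hl))
  have hz : E q l * F q l ∈ centre q :=
    mul_mem (e_pow_mem_centre hs h0 h1 (pow_evenMult hq) (even_evenMult l))
      (f_pow_mem_centre hs h0 h1 (pow_evenMult hq) (even_evenMult l))
  -- `algC q 1` is `ℂ[k, k⁻¹, C]`.
  have hprod : E q l * F q l ∈ algC q 1 := by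
    obtain ⟨h, hh, rfl⟩ : ∃ h, Even h ∧ l = h + h := by
      obtain ⟨r, rfl⟩ := hl
      exact ⟨2 * r, even_two_mul r, by ring⟩
    have hqh : q ^ h = -1 := by
      have := pow_half_eq_neg_one hl0 hle hq
      rwa [show (h + h) / 2 = h by omega] at this
    rw [E, F, evenMult_of_even hle, e_pow_mul_f_pow hs h0 h1, Finset.prod_range_add,
      ← Finset.prod_mul_distrib]
    change _ ∈ (algC q 1).comap (coefHom q s h0)
    refine prod_mem fun i _ => ?_
    rw [efWeight_mul hh hqh]
    have hgen (n : ℤ) : mono n 0 ∈ (algC q 1).comap (coefHom q s h0) := by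
      change coefHom q s h0 (mono n 0) ∈ Subalgebra.toSubmodule (algC q 1)
      rw [coefHom_mono, algC_eq_monoSpan hs h0 h1]
      have : kz q n * scasimir q s ^ 0 = monomial q s (0, n, 0) := by simp [monomial, efPow]
      rw [this]
      exact monomial_mem_monoSpan ⟨rfl, one_dvd _, Even.zero⟩
    have hgen2 : mono 0 2 ∈ (algC q 1).comap (coefHom q s h0) := by
      change coefHom q s h0 (mono 0 2) ∈ Subalgebra.toSubmodule (algC q 1)
      rw [coefHom_mono, algC_eq_monoSpan hs h0 h1]
      have : kz q 0 * scasimir q s ^ 2 = monomial q s (0, 0, 2) := by simp [monomial, efPow]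
      rw [this]
      exact monomial_mem_monoSpan ⟨rfl, dvd_zero _, even_two⟩
    exact Subalgebra.smul_mem _ (sub_mem hgen2 (pow_mem (sub_mem
      (Subalgebra.smul_mem _ (hgen _) _) (Subalgebra.smul_mem _ (hgen _) _)) 2)) _
  -- The index set of the centre is intersected with that of `ℂ[k, k⁻¹, C]`: an even exponent of `S`
  -- gives `q ^ n = 1`, that is, `l ∣ n`.
  change _ ∈ Subalgebra.toSubmodule (centre q) at hz
  change _ ∈ Subalgebra.toSubmodule (algC q 1) at hprod
  change _ ∈ Subalgebra.toSubmodule (algC q l)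
  rw [centre_eq_monoSpan hs h0 h1 hq, mem_monoSpan_iff hs h0 h1] at hz
  rw [algC_eq_monoSpan hs h0 h1, mem_monoSpan_iff hs h0 h1] at hprod ⊢
  intro m hm
  obtain ⟨hd, -, hj⟩ := hprod m hm
  refine ⟨hd, (hq.zpow_eq_one_iff_dvd _).1 ?_, hj⟩
  rw [(hz m hm).2, hj.neg_one_pow]

theorem mul_mem_sumFE_of_mem (hl0 : l ≠ 0) (hl : 4 ∣ l) (hq : IsPrimitiveRoot q l) {x y : U q}
    (hx : x ∈ algF q l) (hy : y ∈ algE q l) : x * y ∈ sumFE q l := by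
  have hle : Subalgebra.toSubmodule (algF q l) * Subalgebra.toSubmodule (algE q l) ≤
      sumFE q l := by
    have hC := algC_eq_monoSpan (l := l) hs h0 h1
    rw [algF_eq_monoSpan hs h0 h1 hq, algE_eq_monoSpan hs h0 h1 hq, monoSpan, monoSpan,
      Submodule.span_mul_span, Submodule.span_le]
    rintro _ ⟨_, ⟨⟨_, p⟩, ⟨⟨c, rfl⟩, hp⟩, rfl⟩, _, ⟨⟨_, p'⟩, ⟨⟨c', rfl⟩, hp'⟩, rfl⟩, rfl⟩
    have hcoef : ∀ p : ℤ × ℕ, (l : ℤ) ∣ p.1 ∧ Even p.2 →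
        kz q p.1 * scasimir q s ^ p.2 ∈ algC q l := fun p hp => by
      change _ ∈ Subalgebra.toSubmodule (algC q l)
      rw [hC]
      have : kz q p.1 * scasimir q s ^ p.2 = monomial q s (0, p) := by simp [monomial, efPow]
      rw [this]
      exact monomial_mem_monoSpan ⟨rfl, hp⟩
    have hEF := E_mul_F_mem_algC hs h0 h1 hl0 hl hq
    have hFc : F q l ∈ centre q :=
      f_pow_mem_centre hs h0 h1 (pow_evenMult hq) (even_evenMult l)
    have hcomm : Commute (E q l) (F q l) := (Subalgebra.mem_center_iff (R := ℂ)).1 hFc _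
    have hX := mul_mem (hcoef p hp) (hcoef p' hp')
    have hprod : monomial q s (-(evenMult l * c : ℤ), p) * monomial q s (evenMult l * c', p') =
        kz q p.1 * scasimir q s ^ p.2 * (kz q p'.1 * scasimir q s ^ p'.2) *
          (E q l ^ c' * F q l ^ c) := by
      have := (Subalgebra.mem_center_iff (R := ℂ)).1 (pow_mem hFc c)
      simp only [monomial, efPow_neg_evenMult_mul, efPow_evenMult_mul]
      rw [mul_assoc (kz q p.1 * scasimir q s ^ p.2), ← this, mul_assoc _ (E q l ^ c'),
        ← mul_assoc]
    change monomial q s (-(evenMult l * c : ℤ), p) * monomial q s (evenMult l * c', p') ∈ _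
    rw [hprod]
    -- Pairing off `min c c'` copies of `E F`, which lie in `algC q l`, leaves a power of only one
    -- of `E` and `F`.
    obtain hcc | hcc := le_total c c'
    · obtain ⟨r, rfl⟩ := Nat.exists_eq_add_of_le' hcc
      rw [pow_add, mul_assoc (E q l ^ r), ← hcomm.mul_pow]
      exact mem_sumFE_of_mem_algE (mul_mem (algC_le_algE hX)
        (mul_mem (pow_mem E_mem_algE r) (algC_le_algE (pow_mem hEF c))))
    · obtain ⟨r, rfl⟩ := Nat.exists_eq_add_of_le hcc
      rw [pow_add, ← mul_assoc (E q l ^ c'), ← hcomm.mul_pow]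
      exact mem_sumFE_of_mem_algF (mul_mem (algC_le_algF hX)
        (mul_mem (algC_le_algF (pow_mem hEF c')) (pow_mem F_mem_algF r)))
  exact hle (Submodule.mul_mem_mul hx hy)

theorem mul_mem_sumFE (hl0 : l ≠ 0) (hl : 4 ∣ l) (hq : IsPrimitiveRoot q l) {x y : U q}
    (hx : x ∈ sumFE q l) (hy : y ∈ sumFE q l) : x * y ∈ sumFE q l := by
  obtain ⟨a, ha, b, hb, rfl⟩ := Submodule.mem_sup.1 hx
  obtain ⟨c, hc, d, hd, rfl⟩ := Submodule.mem_sup.1 hy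
  have hbc : b * c = c * b :=
    ((Subalgebra.mem_center_iff (R := ℂ)).1
      (sumFE_le_centre hs h0 h1 hq (Submodule.mem_sup_right hb)) c).symm
  rw [add_mul, mul_add, mul_add, hbc]
  refine add_mem (add_mem ?_ ?_) (add_mem ?_ ?_)
  · exact mem_sumFE_of_mem_algF (mul_mem ha hc)
  · exact mul_mem_sumFE_of_mem hs h0 h1 hl0 hl hq ha hd
  · exact mul_mem_sumFE_of_mem hs h0 h1 hl0 hl hq hc hb
  · exact mem_sumFE_of_mem_algE (mul_mem hb hd)

theorem exists_basis_centre (hl0 : l ≠ 0) (hl : 4 ∣ l) (hq : IsPrimitiveRoot q l) :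
    ∃ B : Subalgebra ℂ (centre q),
      Subalgebra.toSubmodule (B.map (centre q).val) = sumFE q l ∧
      ∃ b : Module.Basis (Fin 2) B (centre q), b 0 = 1 ∧ (b 1 : U q) = kS q s l := by
  have hle : Even l := (even_iff_two_dvd.2 ((by norm_num : 2 ∣ 4).trans hl))
  have hone : (1 : U q) ∈ sumFE q l := mem_sumFE_of_mem_algF (one_mem _)
  -- The sum is made a subalgebra of `U` and then pulled back to the centre, which contains it.
  let M : Subalgebra ℂ (U q) := (sumFE q l).toSubalgebra hone
    fun _ _ hx hy => mul_mem_sumFE hs h0 h1 hl0 hl hq hx hy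
  refine ⟨M.comap (centre q).val, ?_, ?_⟩
  · ext x
    constructor
    · rintro ⟨y, hy, rfl⟩
      exact hy
    · intro hx
      exact ⟨⟨x, sumFE_le_centre hs h0 h1 hq hx⟩, hx, rfl⟩
  · let κ : centre q := ⟨kS q s l, kS_mem_centre hs h0 h1 hl0 hle hq⟩
    have hli : LinearIndependent (M.comap (centre q).val) ![(1 : centre q), κ] := by
      rw [Fintype.linearIndependent_iffₛ]
      intro u v huv
      have h2 := congrArg (Subtype.val : centre q → U q) huv
      simp only [Fin.sum_univ_two, Matrix.cons_val_zero, Matrix.cons_val_one,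
        Subalgebra.smul_def, smul_eq_mul, mul_one, Subalgebra.coe_add, Subalgebra.coe_mul] at h2
      obtain ⟨hu, hv⟩ := eq_zero_of_add_mul_kS_eq_zero hs h0 h1 hl0 hle hq
        (sub_mem (u 0).2 (v 0).2) (sub_mem (u 1).2 (v 1).2) (by
          rw [sub_mul, sub_add_sub_comm]
          exact sub_eq_zero.2 h2)
      intro i
      fin_cases i
      · exact Subtype.ext (Subtype.ext (sub_eq_zero.1 hu))
      · exact Subtype.ext (Subtype.ext (sub_eq_zero.1 hv))
    have hsp : ⊤ ≤ Submodule.span (M.comap (centre q).val) (Set.range ![(1 : centre q), κ]) := by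
      intro z _
      obtain ⟨u, hu, v, hv, h⟩ := exists_eq_add_mul_kS hs h0 h1 hl0 hle hq z.2
      rw [Matrix.range_cons, Matrix.range_cons, Matrix.range_empty, Set.union_empty,
        Set.singleton_union, Submodule.mem_span_pair]
      refine ⟨⟨⟨u, sumFE_le_centre hs h0 h1 hq hu⟩, hu⟩,
        ⟨⟨v, sumFE_le_centre hs h0 h1 hq hv⟩, hv⟩, Subtype.ext ?_⟩
      rw [h]
      simp [Subalgebra.smul_def, κ]
    refine ⟨Module.Basis.mk hli hsp, ?_, ?_⟩
    · rw [Module.Basis.mk_apply]; rfl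
    · rw [Module.Basis.mk_apply]; rfl

theorem existsUnique_eq_add_mul_kS (hl0 : l ≠ 0) (hl : Even l) (hq : IsPrimitiveRoot q l)
    {z : U q} (hz : z ∈ centre q) :
    ∃! p : sumFE q l × sumFE q l, z = (p.1 : U q) * 1 + (p.2 : U q) * kS q s l := by
  obtain ⟨u, hu, v, hv, h⟩ := exists_eq_add_mul_kS hs h0 h1 hl0 hl hq hz
  refine ⟨(⟨u, hu⟩, ⟨v, hv⟩), by simpa using h, ?_⟩
  rintro ⟨u', v'⟩ h'
  simp only [mul_one] at h'
  have h2 : ((u' : U q) - u) + ((v' : U q) - v) * kS q s l = 0 := by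
    rw [sub_mul, sub_add_sub_comm, ← h', ← h, sub_self]
  obtain ⟨hu', hv'⟩ := eq_zero_of_add_mul_kS_eq_zero hs h0 h1 hl0 hl hq
    (sub_mem u'.2 hu) (sub_mem v'.2 hv) h2
  exact Prod.ext (Subtype.ext (sub_eq_zero.1 hu')) (Subtype.ext (sub_eq_zero.1 hv'))

end Even

end UqOsp

theorem mainTheorem1 (l : ℕ) (hl : 2 < l) (q s : ℂ) (hq : IsPrimitiveRoot q l)
    (hs : s ^ 2 = q) :
    -- the bracketed algebras are (Laurent) polynomial algebras in the displayed elements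
    LinearIndependent ℂ (fun m : ℤ × ℕ × ℕ =>
      ((UqOsp.k q ^ ((l : ℤ) * m.1) : (UqOsp.U q)ˣ) : UqOsp.U q) *
        UqOsp.casimir q ^ m.2.1 * UqOsp.F q l ^ m.2.2) ∧
    LinearIndependent ℂ (fun m : ℤ × ℕ × ℕ =>
      ((UqOsp.k q ^ ((l : ℤ) * m.1) : (UqOsp.U q)ˣ) : UqOsp.U q) *
        UqOsp.casimir q ^ m.2.1 * UqOsp.E q l ^ m.2.2) ∧
    -- the sum lies in the centre, and its two pieces meet in `ℂ[k^l, k^{-l}, C]`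
    UqOsp.sumFE q l ≤ Subalgebra.toSubmodule (UqOsp.centre q) ∧
    UqOsp.algF q l ⊓ UqOsp.algE q l = UqOsp.algC q l ∧
    -- `l` odd: the sum is the centre
    (Odd l → UqOsp.sumFE q l = Subalgebra.toSubmodule (UqOsp.centre q)) ∧
    -- `l` even: the centre is free over the sum with basis `1, k^{l/2} S`
    (Even l →
      UqOsp.kS q s l ∈ UqOsp.centre q ∧
      ∀ z ∈ UqOsp.centre q, ∃! p : UqOsp.sumFE q l × UqOsp.sumFE q l,
        z = (p.1 : UqOsp.U q) * 1 + (p.2 : UqOsp.U q) * UqOsp.kS q s l) ∧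
    -- `4 ∣ l`: the sum is moreover a subalgebra, and the freeness is that of modules over it
    (4 ∣ l → ∃ B : Subalgebra ℂ (UqOsp.centre q),
      Subalgebra.toSubmodule (B.map (UqOsp.centre q).val) = UqOsp.sumFE q l ∧
      ∃ b : Module.Basis (Fin 2) B (UqOsp.centre q),
        b 0 = 1 ∧ (b 1 : UqOsp.U q) = UqOsp.kS q s l) := by
  have h0 : q ≠ 0 := hq.ne_zero (by omega)
  -- This is where `l ≥ 3` enters: it makes `q - q⁻¹` and `s + s⁻¹`, hence `eta q s`, nonzero.
  have h1 : q ^ 2 ≠ 1 := hq.pow_ne_one_of_pos_of_lt (by norm_num) hl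
  have hl0 : l ≠ 0 := by omega
  have hL : UqOsp.evenMult l ≠ 0 := by
    unfold UqOsp.evenMult
    split_ifs <;> simp [hl0]
  refine ⟨?_, ?_, UqOsp.sumFE_le_centre hs h0 h1 hq, UqOsp.algF_inf_algE hs h0 h1 hl0 hq,
    fun hodd => UqOsp.sumFE_eq_centre_of_odd hs h0 h1 hodd hq,
    fun heven => ⟨UqOsp.kS_mem_centre hs h0 h1 hl0 heven hq, fun z hz =>
      UqOsp.existsUnique_eq_add_mul_kS hs h0 h1 hl0 heven hq hz⟩,
    fun h4 => UqOsp.exists_basis_centre hs h0 h1 hl0 h4 hq⟩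
  · refine UqOsp.linearIndependent_kz_casimir_efPow hs h0 h1 hl0
      (D := fun c => -(UqOsp.evenMult l * c)) (fun c c' h => ?_) UqOsp.efPow_neg_evenMult_mul
    simpa [hL] using h
  · refine UqOsp.linearIndependent_kz_casimir_efPow hs h0 h1 hl0
      (D := fun c => UqOsp.evenMult l * c) (fun c c' h => ?_) UqOsp.efPow_evenMult_mul
    simpa [hL] using h
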